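/- **Setting.** Let $n\ge 3$. On $\mathbb R^{n+2}$, with coordinates $x_0,\dots,x_{n+1}$ and basis $e_0,\dots,e_{n+1}$, put $\langle x,y\rangle=-x_0y_0-x_1y_1+x_2y_2+\dots+x_{n+1}y_{n+1}$. The Einstein universe is $\mathcal E^{1,n-1}=\{x: x_0^2+x_1^2=1,\ x_2^2+\dots+x_{n+1}^2=1\}$, with the induced Lorentzian metric; a point $x$ is identified with the null ray $\mathbb R_{>0}x$. Let $\mathcal C_+$ be the set of bivectors $V\wedge W$ with $\langle V,V\rangle=\langle W,W\rangle=\langle V,W\rangle=0$ and $\det(V,W,e_2,\dots,e_{n+1})>0$. Let $I\subseteq\mathbb R$ be an open interval and $\gamma:I\to\mathcal E^{1,n-1}$ a time-like curve, i.e. $\gamma$ is $C^\infty$ and $\langle\gamma',\gamma'\rangle<0$. A null-lift of $\gamma$ is a smooth map $\Gamma=r\gamma:I\to\mathbb R^{n+2}$ with $r>0$. Let $\mathcal T^k|_t=\mathrm{span}(\Gamma,\Gamma',\dots,\Gamma^{(k)})|_t$ and let $\mathcal N^k|_t$ be its $\langle\cdot,\cdot\rangle$-orthogonal complement; these do not depend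 on the null-lift. Let $pr_{(k)}$ be the projection onto $\mathcal N^k$ along $\mathcal T^k$ (used below only where $\mathbb R^{n+2}=\mathcal T^k\oplus\mathcal N^k$). The conformal strain is the quartic differential $$\mathcal Q_\gamma=\frac{\langle pr_{(2)}\Gamma''',pr_{(2)}\Gamma'''\rangle}{|\langle\Gamma',\Gamma'\rangle|}\,dt^4,$$ which does not depend on the null-lift either. The curve $\gamma$ is generic if $\mathcal Q_\gamma$ vanishes nowhere on $I$. Let $\gamma$ be generic. From now on $\Gamma$ denotes its canonical lift, the unique null-lift with $\mathcal Q_\gamma=\langle\Gamma'',\Gamma\rangle^2dt^4$. Put $\upsilon_\gamma=|\langle\Gamma',\Gamma'\rangle|^{1/2}$, $\sigma_\gamma=\upsilon_\gamma\,dt$ and $\dot f=\upsilon_\gamma^{-1}f'$, and define $$M_0=\Gamma,\qquad M_1=\frac{\dot\Gamma}{|\langle\dot\Gamma,\dot\Gamma\rangle|^{1/2}},\qquad M_2=\frac{pr_{(2)}\dddot\Gamma}{\langle pr_{(2)}\dddot\Gamma,pr_{(2)}\dddot\Gamma\rangle^{1/2}},$$ $$M_{n+1}=-\frac{1}{\langle\Gamma,\ddot\Gamma\rangle}\ddot\Gamma+\frac{\langle\dot\Gamma,\ddot\Gamma\rangle}{\langle\Gamma,\ddot\Gamma\rangle}\dot\Gamma+\frac12\Big(\frac{\langle\ddot\Gamma,\ddot\Gamma\rangle}{\langle\Gamma,\ddot\Gamma\rangle^2}-\frac{\langle\dot\Gamma,\ddot\Gamma\rangle^2}{\langle\Gamma,\ddot\Gamma\rangle^2}\Big)\Gamma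 .$$ The curve has its intrinsic orientation if $M_0\wedge(M_1+M_2)\in\mathcal C_+$ everywhere on $I$. For a section $V$ of $\mathcal N^3$ put $DV=pr_{(3)}\dot V$, and set $$S_\gamma=pr_{(3)}\dot M_2,\qquad h_1=\langle\dot M_1,M_{n+1}\rangle,\qquad h_2=\langle S_\gamma,S_\gamma\rangle^{1/2},$$ $$W_\gamma=(\dot h_1-3h_2\dot h_2)M_2-(h_2^2-2h_1)S_\gamma+D^2S_\gamma,$$ where $h_2\dot h_2$ is read as $0$ at the zeros of $S_\gamma$. For a compact interval $K\subset I$ put $\mathcal S_K(\gamma)=\int_K\sigma_\gamma$. The curve $\gamma$ is a conformal world-line if, for every compact interval $K\subset I$ and every smooth map $\mathbf g:I\times(-\epsilon,\epsilon)\to\mathcal E^{1,n-1}$, $\mathbf g(t,\tau)=\gamma_\tau(t)$, $\epsilon>0$, with $\gamma_0=\gamma$ and such that the closure of $\{t\in I:\gamma_\tau(t)\ne\gamma(t)\text{ for some }\tau\in(-\epsilon,\epsilon)\}$ is contained in $K$, the derivative $\frac{d}{d\tau}\mathcal S_K(\gamma_\tau)\big|_{\tau=0}$ exists and vanishes. (For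 $|\tau|$ small, $\gamma_\tau$ is again generic and time-like.) **Theorem.** Let $n\ge 3$, let $I$ be an open interval, and let $\gamma:I\to\mathcal E^{1,n-1}$ be a generic time-like curve with its intrinsic orientation. Then $\gamma$ is a conformal world-line if and only if $W_\gamma=0$ at every point of $I$. -/

import Mathlib

open scoped ContDiff

namespace ConformalStrain

/-- The coordinate space `ℝ^{n+2}`, with coordinates `x_0, …, x_{n+1}`. -/
abbrev Ambient (n : ℕ) : Type := Fin (n + 2) → ℝ

/-- The scalar product of signature `(2, n)`:
`⟨x, y⟩ = - x_0 y_0 - x_1 y_1 + x_2 y_2 + … + x_{n+1} y_{n+1}`. -/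
noncomputable def scalarProduct (n : ℕ) : LinearMap.BilinForm ℝ (Ambient n) :=
  LinearMap.mk₂ ℝ
    (fun x y => -(x 0 * y 0) - x 1 * y 1 + ∑ i : Fin n, x i.succ.succ * y i.succ.succ)
    (by intro x x' y; simp only [Pi.add_apply, add_mul, Finset.sum_add_distrib]; ring)
    (by intro c x y; simp only [Pi.smul_apply, smul_eq_mul, mul_assoc, ← Finset.mul_sum]; ring)
    (by intro x y y'; simp only [Pi.add_apply, mul_add, Finset.sum_add_distrib]; ring)
    (by
      intro c x y
      simp only [Pi.smul_apply, smul_eq_mul, mul_left_comm _ c, ← Finset.mul_sum]; ring)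

/-- The Einstein universe `S¹ × S^{n-1} ⊆ ℝ^{n+2}`. A point `x` of it stands also for the null ray
`ℝ_{>0} x` that it spans. -/
def einsteinUniverse (n : ℕ) : Set (Ambient n) :=
  {x | x 0 ^ 2 + x 1 ^ 2 = 1 ∧ ∑ i : Fin n, x i.succ.succ ^ 2 = 1}

/-- `V ∧ W` lies in the half cone of positive isotropic bivectors. The function that tells the two
half cones apart is `V ∧ W ↦ dV (V, W, e_2, …, e_{n+1})`, where `e_0, …, e_{n+1}` is the basis of
the coordinates `x_0, …, x_{n+1}`; in particular `V ∧ W ≠ 0` where it is positive. -/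
def IsPositiveIsotropic {n : ℕ} (V W : Ambient n) : Prop :=
  scalarProduct n V V = 0 ∧ scalarProduct n W W = 0 ∧ scalarProduct n V W = 0 ∧
    0 < Matrix.det (Matrix.of
      (Fin.cons V (Fin.cons W (fun i : Fin n => Pi.single i.succ.succ 1)) :
        Fin (n + 2) → Fin (n + 2) → ℝ))

/-- A smooth parameterized time-like curve `γ : I → E^{1,n-1}`, `I` an open interval. Values outside
of `I` are irrelevant. -/
structure IsTimelikeCurve {n : ℕ} (I : Set ℝ) (γ : ℝ → Ambient n) : Prop where
  smooth : ContDiffOn ℝ ∞ γ I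
  mem : ∀ t ∈ I, γ t ∈ einsteinUniverse n
  timelike : ∀ t ∈ I, scalarProduct n (deriv γ t) (deriv γ t) < 0

/-- `Γ` is a null-lift of `γ`: a smooth map such that `Γ t` spans the null ray of `γ t`. -/
structure IsNullLift {n : ℕ} (I : Set ℝ) (γ Γ : ℝ → Ambient n) : Prop where
  smooth : ContDiffOn ℝ ∞ Γ I
  ray : ∀ t ∈ I, ∃ r : ℝ, 0 < r ∧ Γ t = r • γ t

/-- The `k`-th osculating space at `t`: the span of `Γ, Γ', …, Γ^{(k)}` at `t`. -/
def osculatingSpace {n : ℕ} (k : ℕ) (Γ : ℝ → Ambient n) (t : ℝ) : Submodule ℝ (Ambient n) :=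
  Submodule.span ℝ {V | ∃ j ≤ k, V = iteratedDeriv j Γ t}

/-- The `k`-th normal space at `t`: the orthogonal complement of the `k`-th osculating space. -/
noncomputable def normalSpace {n : ℕ} (k : ℕ) (Γ : ℝ → Ambient n) (t : ℝ) :
    Submodule ℝ (Ambient n) :=
  (scalarProduct n).orthogonal (osculatingSpace k Γ t)

open Classical in
/-- The orthogonal projection onto the `k`-th normal space along the `k`-th osculating space
(defined when these two are complementary, otherwise set to `0`). -/
noncomputable def normalProj {n : ℕ} (k : ℕ) (Γ : ℝ → Ambient n) (t : ℝ) :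
    Ambient n →ₗ[ℝ] Ambient n :=
  if h : IsCompl (normalSpace k Γ t) (osculatingSpace k Γ t) then
    (normalSpace k Γ t).projection (osculatingSpace k Γ t) h
  else 0

/-- The coefficient of `dt⁴` in the conformal strain, computed with the null-lift `Γ`. -/
noncomputable def strain {n : ℕ} (Γ : ℝ → Ambient n) (t : ℝ) : ℝ :=
  scalarProduct n (normalProj 2 Γ t (iteratedDeriv 3 Γ t)) (normalProj 2 Γ t (iteratedDeriv 3 Γ t)) /
    |scalarProduct n (deriv Γ t) (deriv Γ t)|

/-- A time-like curve is generic when it has no conformal vertices. (The curve is used as its own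
null-lift here; the conformal strain does not depend on the null-lift.) -/
def IsGeneric {n : ℕ} (I : Set ℝ) (γ : ℝ → Ambient n) : Prop :=
  ∀ t ∈ I, strain γ t ≠ 0

/-- `Γ` is a canonical lift of `γ`: a null-lift with `Q_γ = ⟨Γ'', Γ⟩² dt⁴`. -/
structure IsCanonicalLift {n : ℕ} (I : Set ℝ) (γ Γ : ℝ → Ambient n) : Prop where
  nullLift : IsNullLift I γ Γ
  strain_eq : ∀ t ∈ I, strain Γ t = (scalarProduct n (iteratedDeriv 2 Γ t) (Γ t)) ^ 2

/-- The canonical lift of a curve in the Einstein universe, obtained by rescaling the curve itself;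
for a generic time-like curve it is the one and only canonical lift, as shown below. -/
noncomputable def canonicalLift {n : ℕ} (γ : ℝ → Ambient n) (t : ℝ) : Ambient n :=
  (strain γ t / (scalarProduct n (iteratedDeriv 2 γ t) (γ t)) ^ 2) ^ (1 / 4 : ℝ) • γ t

theorem scalarProduct_apply {n : ℕ} (x y : Ambient n) : scalarProduct n x y =
    -(x 0 * y 0) - x 1 * y 1 + ∑ i : Fin n, x i.succ.succ * y i.succ.succ := rfl

theorem scalarProduct_comm {n : ℕ} (x y : Ambient n) :
    scalarProduct n x y = scalarProduct n y x := by
  simp only [scalarProduct_apply, mul_comm]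

theorem scalarProduct_self_of_mem {n : ℕ} {x : Ambient n} (hx : x ∈ einsteinUniverse n) :
    scalarProduct n x x = 0 := by
  have h1 := hx.1
  have h2 := hx.2
  simp only [scalarProduct_apply, ← pow_two]
  linarith

theorem hasDerivAt_scalarProduct {n : ℕ} {f g : ℝ → Ambient n} {f' g' : Ambient n} {t : ℝ}
    (hf : HasDerivAt f f' t) (hg : HasDerivAt g g' t) :
    HasDerivAt (fun s => scalarProduct n (f s) (g s))
      (scalarProduct n f' (g t) + scalarProduct n (f t) g') t := by
  have hf := hasDerivAt_pi.1 hf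
  have hg := hasDerivAt_pi.1 hg
  have := (((hf 0).mul (hg 0)).neg.sub ((hf 1).mul (hg 1))).add
    (HasDerivAt.fun_sum (u := Finset.univ) fun (i : Fin n) _ =>
      (hf i.succ.succ).mul (hg i.succ.succ))
  refine this.congr_deriv ?_
  simp only [scalarProduct_apply, Finset.sum_add_distrib]
  ring

theorem contDiffOn_scalarProduct {n : ℕ} {f g : ℝ → Ambient n} {I : Set ℝ}
    (hf : ContDiffOn ℝ ∞ f I) (hg : ContDiffOn ℝ ∞ g I) :
    ContDiffOn ℝ ∞ (fun s => scalarProduct n (f s) (g s)) I := by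
  have hf := contDiffOn_pi.1 hf
  have hg := contDiffOn_pi.1 hg
  exact (((hf 0).mul (hg 0)).neg.sub ((hf 1).mul (hg 1))).add
    (ContDiffOn.sum fun (i : Fin n) _ => (hf i.succ.succ).mul (hg i.succ.succ))

theorem contDiffOn_iteratedDeriv {F : Type*} [NormedAddCommGroup F] [NormedSpace ℝ F]
    {f : ℝ → F} {I : Set ℝ} (hI : IsOpen I) (hf : ContDiffOn ℝ ∞ f I) (k : ℕ) :
    ContDiffOn ℝ ∞ (iteratedDeriv k f) I := by
  induction k with
  | zero => simpa using hf
  | succ k ih =>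
    rw [iteratedDeriv_succ]
    exact ((contDiffOn_infty_iff_deriv_of_isOpen hI).1 ih).2

theorem hasDerivAt_iteratedDeriv {F : Type*} [NormedAddCommGroup F] [NormedSpace ℝ F]
    {f : ℝ → F} {I : Set ℝ} (hI : IsOpen I) (hf : ContDiffOn ℝ ∞ f I) (k : ℕ) {t : ℝ}
    (ht : t ∈ I) : HasDerivAt (iteratedDeriv k f) (iteratedDeriv (k + 1) f t) t := by
  rw [iteratedDeriv_succ]
  exact (((contDiffOn_iteratedDeriv hI hf k).differentiableOn (by simp)).differentiableAt
    (hI.mem_nhds ht)).hasDerivAt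

theorem hasDerivAt_unique_of_eqOn {F : Type*} [NormedAddCommGroup F] [NormedSpace ℝ F]
    {f g : ℝ → F} {f' g' : F} {I : Set ℝ} (hI : IsOpen I) (h : Set.EqOn f g I) {t : ℝ}
    (ht : t ∈ I) (hf : HasDerivAt f f' t) (hg : HasDerivAt g g' t) : f' = g' :=
  hf.unique (hg.congr_of_eventuallyEq (h.eventuallyEq_of_mem (hI.mem_nhds ht)))

theorem osculatingSpace_two {n : ℕ} (Γ : ℝ → Ambient n) (t : ℝ) : osculatingSpace 2 Γ t =
    Submodule.span ℝ {Γ t, iteratedDeriv 1 Γ t, iteratedDeriv 2 Γ t} := by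
  unfold osculatingSpace
  congr 1
  ext V
  simp only [Set.mem_ofPred_eq, Set.mem_insert_iff, Set.mem_singleton_iff]
  constructor
  · rintro ⟨j, hj, rfl⟩
    interval_cases j <;> simp
  · rintro (rfl | rfl | rfl)
    · exact ⟨0, by simp⟩
    · exact ⟨1, by simp⟩
    · exact ⟨2, by simp⟩

theorem mem_orthogonal_span_triple {n : ℕ} {a b c V : Ambient n} :
    V ∈ (scalarProduct n).orthogonal (Submodule.span ℝ {a, b, c}) ↔
      scalarProduct n a V = 0 ∧ scalarProduct n b V = 0 ∧ scalarProduct n c V = 0 := by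
  rw [LinearMap.BilinForm.mem_orthogonal_iff]
  constructor
  · intro h
    exact ⟨h a (Submodule.subset_span (by simp)), h b (Submodule.subset_span (by simp)),
      h c (Submodule.subset_span (by simp))⟩
  · rintro ⟨ha, hb, hc⟩ x hx
    obtain ⟨p, q, r, rfl⟩ := Submodule.mem_span_triple.1 hx
    simp [ha, hb, hc]

/-- The relations between the first derivatives of a null-lift of a time-like curve. -/
theorem IsTimelikeCurve.relations {n : ℕ} {I : Set ℝ} (hI : IsOpen I) {γ : ℝ → Ambient n}
    (hγ : IsTimelikeCurve I γ) {t : ℝ} (ht : t ∈ I) :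
    scalarProduct n (γ t) (γ t) = 0 ∧ scalarProduct n (γ t) (iteratedDeriv 1 γ t) = 0 ∧
      scalarProduct n (γ t) (iteratedDeriv 2 γ t) =
        -scalarProduct n (iteratedDeriv 1 γ t) (iteratedDeriv 1 γ t) ∧
      scalarProduct n (iteratedDeriv 1 γ t) (iteratedDeriv 1 γ t) < 0 := by
  have h0 : Set.EqOn (fun s => scalarProduct n (γ s) (γ s)) (fun _ => 0) I :=
    fun s hs => scalarProduct_self_of_mem (hγ.mem s hs)
  have h1 : Set.EqOn (fun s => scalarProduct n (γ s) (iteratedDeriv 1 γ s)) (fun _ => 0) I := by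
    intro s hs
    have hd := hasDerivAt_iteratedDeriv hI hγ.smooth 0 hs
    simp only [iteratedDeriv_zero, zero_add] at hd
    have := hasDerivAt_unique_of_eqOn hI h0 hs (hasDerivAt_scalarProduct hd hd)
      (hasDerivAt_const s 0)
    rw [scalarProduct_comm (iteratedDeriv 1 γ s)] at this
    simp only
    linarith
  refine ⟨h0 ht, h1 ht, ?_, ?_⟩
  · have hd := hasDerivAt_iteratedDeriv hI hγ.smooth 0 ht
    simp only [iteratedDeriv_zero, zero_add] at hd
    have := hasDerivAt_unique_of_eqOn hI h1 ht
      (hasDerivAt_scalarProduct hd (hasDerivAt_iteratedDeriv hI hγ.smooth 1 ht))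
      (hasDerivAt_const t 0)
    simp only [one_add_one_eq_two] at this
    linarith
  · rw [iteratedDeriv_one]
    exact hγ.timelike t ht

/-- An explicit formula for the projection to the second normal space. -/
theorem exists_projection {n : ℕ} {a b c : Ambient n} (haa : scalarProduct n a a = 0)
    (hab : scalarProduct n a b = 0)
    (hac : scalarProduct n a c = -scalarProduct n b b) (hbb : scalarProduct n b b < 0) :
    IsCompl ((scalarProduct n).orthogonal (Submodule.span ℝ {a, b, c}))
      (Submodule.span ℝ {a, b, c}) ∧
    ∀ V : Ambient n,
      let z := scalarProduct n a V / scalarProduct n a c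
      let y := (scalarProduct n b V - z * scalarProduct n b c) / scalarProduct n b b
      let x := (scalarProduct n c V - y * scalarProduct n b c - z * scalarProduct n c c) /
        scalarProduct n a c
      V - (x • a + y • b + z • c) ∈ (scalarProduct n).orthogonal (Submodule.span ℝ {a, b, c}) := by
  have hne : scalarProduct n a c ≠ 0 := by linarith
  have hne' : scalarProduct n b b ≠ 0 := by linarith
  have hba := scalarProduct_comm b a
  have hca := scalarProduct_comm c a
  have hcb := scalarProduct_comm c b
  rw [and_comm]
  refine and_iff_left_of_imp ?_ |>.2 ?_
  · intro h
    refine ⟨?_, ?_⟩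
    · rw [Submodule.disjoint_def]
      intro v hv hv'
      obtain ⟨p, q, r, rfl⟩ := Submodule.mem_span_triple.1 hv'
      obtain ⟨h1, h2, h3⟩ := mem_orthogonal_span_triple.1 hv
      simp only [map_add, map_smul, smul_eq_mul, haa, hab, hba, hca, hcb] at h1 h2 h3
      have hr : r = 0 := by
        have : r * scalarProduct n a c = 0 := by linarith
        exact (mul_eq_zero.1 this).resolve_right hne
      subst hr
      have hq : q = 0 := by
        have : q * scalarProduct n b b = 0 := by linarith
        exact (mul_eq_zero.1 this).resolve_right hne'
      subst hq
      have hp : p = 0 := by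
        have : p * scalarProduct n a c = 0 := by linarith
        exact (mul_eq_zero.1 this).resolve_right hne
      subst hp
      simp
    · rw [codisjoint_iff, Submodule.eq_top_iff']
      intro V
      exact Submodule.mem_sup.2 ⟨_, h V, _, Submodule.mem_span_triple.2 ⟨_, _, _, rfl⟩,
        sub_add_cancel _ _⟩
  · intro V z y x
    have hz : z * scalarProduct n a c = scalarProduct n a V := div_mul_cancel₀ _ hne
    have hy : y * scalarProduct n b b = scalarProduct n b V - z * scalarProduct n b c :=
      div_mul_cancel₀ _ hne'
    have hx : x * scalarProduct n a c = scalarProduct n c V - y * scalarProduct n b c -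
      z * scalarProduct n c c := div_mul_cancel₀ _ hne
    rw [mem_orthogonal_span_triple]
    simp only [map_sub, map_add, map_smul, smul_eq_mul, haa, hab, hba, hca, hcb]
    refine ⟨?_, ?_, ?_⟩ <;> linarith

/-- The second normal space of a time-like curve is space-like. -/
theorem nonneg_of_orthogonal {n : ℕ} {a b c V : Ambient n} (haa : scalarProduct n a a = 0)
    (hab : scalarProduct n a b = 0)
    (hac : scalarProduct n a c = -scalarProduct n b b) (hbb : scalarProduct n b b < 0)
    (hV : V ∈ (scalarProduct n).orthogonal (Submodule.span ℝ {a, b, c})) :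
    0 ≤ scalarProduct n V V := by
  by_contra! hneg
  obtain ⟨h1, h2, h3⟩ := mem_orthogonal_span_triple.1 hV
  have hba := scalarProduct_comm b a
  have hca := scalarProduct_comm c a
  have hcb := scalarProduct_comm c b
  have hne : scalarProduct n a c ≠ 0 := by linarith
  have hne' : scalarProduct n b b ≠ 0 := by linarith
  -- a time-like vector orthogonal to `b` and `V`
  obtain ⟨y, hy⟩ : ∃ y : ℝ, scalarProduct n b c + y * scalarProduct n b b = 0 :=
    ⟨-scalarProduct n b c / scalarProduct n b b, by field_simp; ring⟩
  obtain ⟨x, hx⟩ : ∃ x : ℝ, scalarProduct n (c + y • b) (c + y • b) +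
      2 * x * scalarProduct n a c = -1 :=
    ⟨(-1 - scalarProduct n (c + y • b) (c + y • b)) / (2 * scalarProduct n a c), by
      field_simp; ring⟩
  set A : Ambient n := c + y • b + x • a with hA
  have hAb : scalarProduct n A b = 0 := by
    simp only [hA, map_add, map_smul, LinearMap.add_apply, LinearMap.smul_apply, smul_eq_mul,
      hcb, hab]
    linarith
  have hAV : scalarProduct n A V = 0 := by
    simp only [hA, map_add, map_smul, LinearMap.add_apply, LinearMap.smul_apply, smul_eq_mul,
      h1, h2, h3]
    ring
  have hAA : scalarProduct n A A = -1 := by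
    rw [← hx]
    simp only [hA, map_add, map_smul, LinearMap.add_apply, LinearMap.smul_apply, smul_eq_mul,
      hba, hca, hcb, hab, haa]
    ring
  let L : (Fin 3 → ℝ) →ₗ[ℝ] (Fin 2 → ℝ) := Matrix.toLin' !![A 0, b 0, V 0; A 1, b 1, V 1]
  have hL : LinearMap.ker L ≠ ⊥ := LinearMap.ker_ne_bot_of_finrank_lt (by simp)
  obtain ⟨w, hw, hw0⟩ := (Submodule.ne_bot_iff _).1 hL
  rw [LinearMap.mem_ker] at hw
  have e0 : w 0 * A 0 + w 1 * b 0 + w 2 * V 0 = 0 := by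
    have := congrFun hw 0
    simp [L, Matrix.mulVec, dotProduct, Fin.sum_univ_three] at this
    linarith
  have e1 : w 0 * A 1 + w 1 * b 1 + w 2 * V 1 = 0 := by
    have := congrFun hw 1
    simp [L, Matrix.mulVec, dotProduct, Fin.sum_univ_three] at this
    linarith
  set U : Ambient n := w 0 • A + w 1 • b + w 2 • V with hU
  have hUU : 0 ≤ scalarProduct n U U := by
    have u0 : U 0 = 0 := by simpa [hU] using e0
    have u1 : U 1 = 0 := by simpa [hU] using e1
    rw [scalarProduct_apply, u0, u1]
    have : 0 ≤ ∑ i : Fin n, U i.succ.succ * U i.succ.succ :=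
      Finset.sum_nonneg fun i _ => mul_self_nonneg _
    linarith
  have hUU' : scalarProduct n U U = w 0 ^ 2 * -1 + w 1 ^ 2 * scalarProduct n b b +
      w 2 ^ 2 * scalarProduct n V V := by
    simp only [hU, map_add, map_smul, LinearMap.add_apply, LinearMap.smul_apply, smul_eq_mul,
      hAb, hAV, hAA, scalarProduct_comm b A, scalarProduct_comm V A, scalarProduct_comm V b, h2]
    ring
  have k0 : 0 ≤ w 0 ^ 2 := sq_nonneg _
  have k1 : w 1 ^ 2 * scalarProduct n b b ≤ 0 := by nlinarith [sq_nonneg (w 1)]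
  have k2 : w 2 ^ 2 * scalarProduct n V V ≤ 0 := by nlinarith [sq_nonneg (w 2)]
  have z0 : w 0 = 0 := by
    have : w 0 ^ 2 = 0 := by linarith
    simpa using this
  have z1 : w 1 = 0 := by
    have : w 1 ^ 2 * scalarProduct n b b = 0 := by linarith
    simpa [hne'] using this
  have z2 : w 2 = 0 := by
    have : w 2 ^ 2 * scalarProduct n V V = 0 := by linarith
    simpa [hneg.ne] using this
  apply hw0
  ext i
  fin_cases i <;> simp [z0, z1, z2]

theorem normalProj_congr {n k : ℕ} {Γ Γ' : ℝ → Ambient n} {t : ℝ}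
    (h : osculatingSpace k Γ t = osculatingSpace k Γ' t) :
    normalProj k Γ t = normalProj k Γ' t := by
  unfold normalProj normalSpace
  generalize osculatingSpace k Γ t = T at h
  subst h
  rfl

theorem normalProj_eq_zero {n k : ℕ} {Γ : ℝ → Ambient n} {t : ℝ} {V : Ambient n}
    (h : V ∈ osculatingSpace k Γ t) : normalProj k Γ t V = 0 := by
  unfold normalProj
  split_ifs with hc
  · exact (Submodule.projection_apply_eq_zero_iff hc).2 h
  · rfl

theorem normalProj_eq {n k : ℕ} {Γ : ℝ → Ambient n} {t : ℝ} {V P : Ambient n}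
    (hc : IsCompl (normalSpace k Γ t) (osculatingSpace k Γ t)) (hP : P ∈ normalSpace k Γ t)
    (h : V - P ∈ osculatingSpace k Γ t) : normalProj k Γ t V = P := by
  have h1 : normalProj k Γ t P = P := by
    unfold normalProj
    rw [dif_pos hc]
    exact Submodule.projection_apply_left hc ⟨P, hP⟩
  have h2 := normalProj_eq_zero h
  rw [map_sub, h1, sub_eq_zero] at h2
  exact h2

/-- The conformal strain does not depend on the null-lift, and `⟨Γ'', Γ⟩` is multiplied by `r²` when
the null-lift is multiplied by `r`. -/
theorem strain_rescale {n : ℕ} {I : Set ℝ} (hI : IsOpen I) {γ Γ : ℝ → Ambient n} {r : ℝ → ℝ}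
    (hγ : IsTimelikeCurve I γ) (hr : ContDiffOn ℝ ∞ r I) (hr0 : ∀ t ∈ I, 0 < r t)
    (hΓ : ContDiffOn ℝ ∞ Γ I) (h : ∀ t ∈ I, Γ t = r t • γ t) {t : ℝ} (ht : t ∈ I) :
    strain Γ t = strain γ t ∧ scalarProduct n (iteratedDeriv 2 Γ t) (Γ t) =
      r t ^ 2 * scalarProduct n (iteratedDeriv 2 γ t) (γ t) := by
  have G0 : Set.EqOn (iteratedDeriv 0 Γ) (fun s => iteratedDeriv 0 r s • iteratedDeriv 0 γ s) I :=
    fun s hs => by simpa using h s hs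
  have hd := fun k {s : ℝ} (hs : s ∈ I) => hasDerivAt_iteratedDeriv hI hγ.smooth k hs
  have hD := fun k {s : ℝ} (hs : s ∈ I) => hasDerivAt_iteratedDeriv hI hΓ k hs
  have hρ := fun k {s : ℝ} (hs : s ∈ I) => hasDerivAt_iteratedDeriv hI hr k hs
  have G1 : Set.EqOn (iteratedDeriv 1 Γ) (fun s => iteratedDeriv 0 r s • iteratedDeriv 1 γ s +
      iteratedDeriv 1 r s • iteratedDeriv 0 γ s) I := fun s hs =>
    hasDerivAt_unique_of_eqOn hI G0 hs (hD 0 hs) ((hρ 0 hs).smul (hd 0 hs))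
  have G2 : Set.EqOn (iteratedDeriv 2 Γ) (fun s => iteratedDeriv 0 r s • iteratedDeriv 2 γ s +
      (2 * iteratedDeriv 1 r s) • iteratedDeriv 1 γ s +
      iteratedDeriv 2 r s • iteratedDeriv 0 γ s) I := by
    intro s hs
    rw [hasDerivAt_unique_of_eqOn hI G1 hs (hD 1 hs)
      (((hρ 0 hs).smul (hd 1 hs)).add ((hρ 1 hs).smul (hd 0 hs)))]
    simp only [zero_add, one_add_one_eq_two]
    module
  have G3 : iteratedDeriv 3 Γ t = iteratedDeriv 0 r t • iteratedDeriv 3 γ t +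
      (3 * iteratedDeriv 1 r t) • iteratedDeriv 2 γ t +
      (3 * iteratedDeriv 2 r t) • iteratedDeriv 1 γ t +
      iteratedDeriv 3 r t • iteratedDeriv 0 γ t := by
    rw [hasDerivAt_unique_of_eqOn hI G2 ht (hD 2 ht)
      ((((hρ 0 ht).smul (hd 2 ht)).add (((hρ 1 ht).const_mul 2).smul (hd 1 ht))).add
        ((hρ 2 ht).smul (hd 0 ht)))]
    simp only [zero_add, one_add_one_eq_two, two_add_one_eq_three]
    module
  have G0 := G0 ht
  have G1 := G1 ht
  have G2 := G2 ht
  simp only [iteratedDeriv_zero] at G0 G1 G2 G3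
  obtain ⟨r1, r2, r3, r4⟩ := hγ.relations hI ht
  have hr0 := hr0 t ht
  have hT : osculatingSpace 2 Γ t = osculatingSpace 2 γ t := by
    rw [osculatingSpace_two, osculatingSpace_two]
    apply le_antisymm
    · rw [Submodule.span_le]
      rintro v (rfl | rfl | rfl)
      · exact Submodule.mem_span_triple.2 ⟨r t, 0, 0, by rw [G0]; module⟩
      · exact Submodule.mem_span_triple.2 ⟨iteratedDeriv 1 r t, r t, 0, by rw [G1]; module⟩
      · exact Submodule.mem_span_triple.2
          ⟨iteratedDeriv 2 r t, 2 * iteratedDeriv 1 r t, r t, by rw [G2]; module⟩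
    · rw [Submodule.span_le]
      set T := Submodule.span ℝ {Γ t, iteratedDeriv 1 Γ t, iteratedDeriv 2 Γ t}
      have m0 : Γ t ∈ T := Submodule.subset_span (by simp)
      have m1 : iteratedDeriv 1 Γ t ∈ T := Submodule.subset_span (by simp)
      have m2 : iteratedDeriv 2 Γ t ∈ T := Submodule.subset_span (by simp)
      have n0 : γ t ∈ T := by
        rw [G0] at m0
        exact (T.smul_mem_iff hr0.ne').1 m0
      have n1 : iteratedDeriv 1 γ t ∈ T := by
        rw [G1] at m1
        exact (T.smul_mem_iff hr0.ne').1 ((T.add_mem_iff_left (T.smul_mem _ n0)).1 m1)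
      have n2 : iteratedDeriv 2 γ t ∈ T := by
        rw [G2] at m2
        exact (T.smul_mem_iff hr0.ne').1 ((T.add_mem_iff_left (T.smul_mem _ n1)).1
          ((T.add_mem_iff_left (T.smul_mem _ n0)).1 m2))
      rintro v (rfl | rfl | rfl) <;> assumption
  have z (k : ℕ) (hk : k ≤ 2) : normalProj 2 γ t (iteratedDeriv k γ t) = 0 :=
    normalProj_eq_zero (Submodule.subset_span ⟨k, hk, rfl⟩)
  have z0 := z 0 (by simp)
  rw [iteratedDeriv_zero] at z0
  constructor
  · unfold strain
    rw [normalProj_congr hT, ← iteratedDeriv_one (f := Γ), ← iteratedDeriv_one (f := γ), G1, G3]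
    simp only [map_add, map_smul, z0, z 1 (by simp), z 2 le_rfl, smul_zero, add_zero,
      LinearMap.add_apply, LinearMap.smul_apply, smul_eq_mul, r1, r2,
      scalarProduct_comm (iteratedDeriv 1 γ t) (γ t), mul_zero, ← mul_assoc, ← pow_two]
    rw [abs_mul, abs_of_pos (pow_pos hr0 2), mul_div_mul_left _ _ (pow_pos hr0 2).ne']
  · rw [G2, G0]
    simp only [map_add, map_smul, LinearMap.add_apply, LinearMap.smul_apply, smul_eq_mul, r1,
      scalarProduct_comm (iteratedDeriv 1 γ t) (γ t), r2]
    ring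

theorem strain_smooth_pos {n : ℕ} {I : Set ℝ} (hI : IsOpen I) {γ : ℝ → Ambient n}
    (hγ : IsTimelikeCurve I γ) :
    ContDiffOn ℝ ∞ (strain γ) I ∧ ∀ t ∈ I, 0 ≤ strain γ t := by
  have sm := fun k => contDiffOn_iteratedDeriv hI hγ.smooth k
  have key (t : ℝ) (ht : t ∈ I) := by
    obtain ⟨r1, r2, r3, r4⟩ := hγ.relations hI ht
    exact exists_projection r1 r2 r3 r4
  have hN (t : ℝ) : normalSpace 2 γ t = (scalarProduct n).orthogonal
      (Submodule.span ℝ {γ t, iteratedDeriv 1 γ t, iteratedDeriv 2 γ t}) := by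
    unfold normalSpace
    rw [osculatingSpace_two]
  have hP (t : ℝ) (ht : t ∈ I) := (key t ht).2 (iteratedDeriv 3 γ t)
  simp only [← hN] at hP
  have e (t : ℝ) (ht : t ∈ I) := normalProj_eq (k := 2) (Γ := γ) (t := t)
    (V := iteratedDeriv 3 γ t) (by rw [hN, osculatingSpace_two]; exact (key t ht).1) (hP t ht)
    (by
      rw [osculatingSpace_two, sub_sub_cancel]
      exact Submodule.mem_span_triple.2 ⟨_, _, _, rfl⟩)
  have hs := fun i j => contDiffOn_scalarProduct (sm i) (sm j)
  have hn (t : ℝ) (ht : t ∈ I) := (hγ.relations hI ht).2.2.2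
  have hn1 (t : ℝ) (ht : t ∈ I) :
      scalarProduct n (iteratedDeriv 1 γ t) (iteratedDeriv 1 γ t) ≠ 0 := (hn t ht).ne
  have hn2 (t : ℝ) (ht : t ∈ I) :
      scalarProduct n (iteratedDeriv 0 γ t) (iteratedDeriv 2 γ t) ≠ 0 := by
    rw [iteratedDeriv_zero, (hγ.relations hI ht).2.2.1]
    exact neg_ne_zero.2 (hn1 t ht)
  constructor
  · have hP : ContDiffOn ℝ ∞ (fun t => normalProj 2 γ t (iteratedDeriv 3 γ t)) I := by
      refine ContDiffOn.congr ?_ e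
      have hz := (hs 0 3).div (hs 0 2) hn2
      have hy := ((hs 1 3).sub (hz.mul (hs 1 2))).div (hs 1 1) hn1
      have hx := (((hs 2 3).sub (hy.mul (hs 1 2))).sub (hz.mul (hs 2 2))).div (hs 0 2) hn2
      exact (sm 3).sub (((hx.smul (sm 0)).add (hy.smul (sm 1))).add (hz.smul (sm 2)))
    have : ContDiffOn ℝ ∞ (fun t => scalarProduct n (normalProj 2 γ t (iteratedDeriv 3 γ t))
        (normalProj 2 γ t (iteratedDeriv 3 γ t)) /
        -scalarProduct n (iteratedDeriv 1 γ t) (iteratedDeriv 1 γ t)) I :=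
      (contDiffOn_scalarProduct hP hP).div (hs 1 1).neg fun t ht => neg_ne_zero.2 (hn1 t ht)
    refine this.congr fun t ht => ?_
    rw [strain, iteratedDeriv_one, abs_of_neg (hγ.timelike t ht)]
  · intro t ht
    obtain ⟨r1, r2, r3, r4⟩ := hγ.relations hI ht
    refine div_nonneg ?_ (abs_nonneg _)
    rw [e t ht]
    exact nonneg_of_orthogonal r1 r2 r3 r4 ((key t ht).2 _)

/-- Existence of the canonical lift. -/
theorem isCanonicalLift_canonicalLift {n : ℕ} {I : Set ℝ} (hI : IsOpen I) {γ : ℝ → Ambient n}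
    (hγ : IsTimelikeCurve I γ) (hgen : IsGeneric I γ) :
    IsCanonicalLift I γ (canonicalLift γ) := by
  obtain ⟨hs, hp⟩ := strain_smooth_pos hI hγ
  have sm := fun k => contDiffOn_iteratedDeriv hI hγ.smooth k
  have hq (t : ℝ) (ht : t ∈ I) : 0 < strain γ t := lt_of_le_of_ne (hp t ht) (hgen t ht).symm
  have hd (t : ℝ) (ht : t ∈ I) : 0 < (scalarProduct n (iteratedDeriv 2 γ t) (γ t)) ^ 2 := by
    have := hγ.relations hI ht
    rw [scalarProduct_comm, this.2.2.1, neg_sq]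
    exact sq_pos_of_neg this.2.2.2
  have hpos (t : ℝ) (ht : t ∈ I) := div_pos (hq t ht) (hd t ht)
  have hr : ContDiffOn ℝ ∞ (fun t =>
      (strain γ t / (scalarProduct n (iteratedDeriv 2 γ t) (γ t)) ^ 2) ^ (1 / 4 : ℝ)) I :=
    (hs.div ((contDiffOn_scalarProduct (sm 2) hγ.smooth).pow 2)
      fun t ht => (hd t ht).ne').rpow_const_of_ne fun t ht => (hpos t ht).ne'
  have hsm : ContDiffOn ℝ ∞ (canonicalLift γ) I := hr.smul hγ.smooth
  have hr0 (t : ℝ) (ht : t ∈ I) := Real.rpow_pos_of_pos (hpos t ht) (1 / 4)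
  refine ⟨⟨hsm, fun t ht => ⟨_, hr0 t ht, rfl⟩⟩, fun t ht => ?_⟩
  obtain ⟨h1, h2⟩ := strain_rescale hI hγ hr hr0 hsm (fun _ _ => rfl) ht
  rw [h1, h2, mul_pow, ← pow_mul, ← Real.rpow_natCast, ← Real.rpow_mul (hpos t ht).le]
  norm_num
  rw [div_mul_cancel₀ _ (hd t ht).ne']

/-- Uniqueness of the canonical lift. -/
theorem IsCanonicalLift.eqOn {n : ℕ} {I : Set ℝ} (hI : IsOpen I) {γ Γ : ℝ → Ambient n}
    (hγ : IsTimelikeCurve I γ) (hΓ : IsCanonicalLift I γ Γ) :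
    Set.EqOn Γ (canonicalLift γ) I := by
  choose! r hr0 hr using hΓ.nullLift.ray
  have hΓc := contDiffOn_pi.1 hΓ.nullLift.smooth
  have hγc := contDiffOn_pi.1 hγ.smooth
  have hrs : ContDiffOn ℝ ∞ r I := by
    refine (((hΓc 0).mul (hγc 0)).add ((hΓc 1).mul (hγc 1))).congr fun t ht => ?_
    have h1 := (hγ.mem t ht).1
    simp only [hr t ht, Pi.smul_apply, smul_eq_mul]
    linear_combination (-r t) * h1
  intro t ht
  obtain ⟨h1, h2⟩ := strain_rescale hI hγ hrs hr0 hΓ.nullLift.smooth hr ht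
  have h3 := hΓ.strain_eq t ht
  have hd : (scalarProduct n (iteratedDeriv 2 γ t) (γ t)) ^ 2 ≠ 0 := by
    have := hγ.relations hI ht
    rw [scalarProduct_comm, this.2.2.1, neg_sq]
    exact pow_ne_zero 2 this.2.2.2.ne
  rw [h1, h2, mul_pow, ← pow_mul] at h3
  rw [canonicalLift, h3, mul_div_cancel_right₀ _ hd, hr t ht, ← Real.rpow_natCast,
    ← Real.rpow_mul (hr0 t ht).le]
  norm_num

/-- The conformal strain density `υ_γ`. -/
noncomputable def strainDensity {n : ℕ} (γ : ℝ → Ambient n) (t : ℝ) : ℝ :=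
  Real.sqrt |scalarProduct n (deriv (canonicalLift γ) t) (deriv (canonicalLift γ) t)|

/-- The derivative with respect to the conformal arc element of `γ`. -/
noncomputable def dot {n : ℕ} {F : Type*} [NormedAddCommGroup F] [NormedSpace ℝ F]
    (γ : ℝ → Ambient n) (f : ℝ → F) (t : ℝ) : F :=
  (strainDensity γ t)⁻¹ • deriv f t

/-- `M_0 = Γ`. -/
noncomputable def M₀ {n : ℕ} (γ : ℝ → Ambient n) : ℝ → Ambient n := canonicalLift γ

/-- `M_1 = |⟨Γ̇, Γ̇⟩|^{-1/2} Γ̇`. -/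
noncomputable def M₁ {n : ℕ} (γ : ℝ → Ambient n) (t : ℝ) : Ambient n :=
  let Γ₁ := dot γ (canonicalLift γ)
  (1 / Real.sqrt |scalarProduct n (Γ₁ t) (Γ₁ t)|) • Γ₁ t

/-- `M_2`: the projection of the third derivative of `Γ` to the second normal space, normalized. -/
noncomputable def M₂ {n : ℕ} (γ : ℝ → Ambient n) (t : ℝ) : Ambient n :=
  let Γ₃ := dot γ (dot γ (dot γ (canonicalLift γ)))
  let P := normalProj 2 (canonicalLift γ) t (Γ₃ t)
  (1 / √(scalarProduct n P P)) • P

/-- `M_{n+1}`, the last member of the canonical trivialization. -/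
noncomputable def Mlast {n : ℕ} (γ : ℝ → Ambient n) (t : ℝ) : Ambient n :=
  let Γ := canonicalLift γ
  let Γ₁ := dot γ Γ
  let Γ₂ := dot γ Γ₁
  let a := scalarProduct n (Γ t) (Γ₂ t)
  let b := scalarProduct n (Γ₁ t) (Γ₂ t)
  let c := scalarProduct n (Γ₂ t) (Γ₂ t)
  (-(1 / a)) • Γ₂ t + (b / a) • Γ₁ t + (1 / 2 * (c / a ^ 2 - b ^ 2 / a ^ 2)) • Γ t

/-- The parameterization of `γ` agrees with the intrinsic orientation:
`M_0 ∧ (M_1 + M_2)` is a positive isotropic bivector everywhere. -/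
def IsIntrinsicallyOriented {n : ℕ} (I : Set ℝ) (γ : ℝ → Ambient n) : Prop :=
  ∀ t ∈ I, IsPositiveIsotropic (M₀ γ t) (M₁ γ t + M₂ γ t)

/-- The covariant derivative of sections of the third normal bundle. -/
noncomputable def covDeriv {n : ℕ} (γ V : ℝ → Ambient n) (t : ℝ) : Ambient n :=
  normalProj 3 (canonicalLift γ) t (dot γ V t)

/-- The canonical section `S_γ` of the third normal bundle. -/
noncomputable def Ssec {n : ℕ} (γ : ℝ → Ambient n) (t : ℝ) : Ambient n :=
  normalProj 3 (canonicalLift γ) t (dot γ (M₂ γ) t)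

/-- `h_1 = ⟨Ṁ_1, M_{n+1}⟩`. -/
noncomputable def h₁ {n : ℕ} (γ : ℝ → Ambient n) (t : ℝ) : ℝ :=
  scalarProduct n (dot γ (M₁ γ) t) (Mlast γ t)

/-- `h_2 = ⟨S_γ, S_γ⟩^{1/2}`. It may fail to be differentiable at a zero of `S_γ`, but there the
product `h_2 ḣ_2` below vanishes, in accordance with `2 h_2 ḣ_2 = (h_2²)˙`. -/
noncomputable def h₂ {n : ℕ} (γ : ℝ → Ambient n) (t : ℝ) : ℝ :=
  √(scalarProduct n (Ssec γ t) (Ssec γ t))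

/-- The canonical section `W_γ` of the second normal bundle:
`W_γ = (ḣ_1 - 3 h_2 ḣ_2) M_2 - (h_2² - 2 h_1) S_γ + D² S_γ`. -/
noncomputable def Wsec {n : ℕ} (γ : ℝ → Ambient n) (t : ℝ) : Ambient n :=
  (dot γ (h₁ γ) t - 3 * h₂ γ t * dot γ (h₂ γ) t) • M₂ γ t
    - (h₂ γ t ^ 2 - 2 * h₁ γ t) • Ssec γ t
    + covDeriv γ (covDeriv γ (Ssec γ)) t

/-- The total strain of `γ` over `K = [a, b]`. -/
noncomputable def totalStrain {n : ℕ} (a b : ℝ) (γ : ℝ → Ambient n) : ℝ :=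
  ∫ t in Set.Icc a b, strainDensity γ t

/-- `(t, τ) ↦ g t τ` is a smooth variation of `γ`, with parameter `τ ∈ (-ε, ε)`. -/
structure IsVariation {n : ℕ} (I : Set ℝ) (γ : ℝ → Ambient n) (ε : ℝ) (g : ℝ → ℝ → Ambient n) :
    Prop where
  pos : 0 < ε
  smooth : ContDiffOn ℝ ∞ (fun p : ℝ × ℝ => g p.1 p.2) (I ×ˢ Set.Ioo (-ε) ε)
  mem : ∀ t ∈ I, ∀ τ ∈ Set.Ioo (-ε) ε, g t τ ∈ einsteinUniverse n
  zero : ∀ t ∈ I, g t 0 = γ t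

/-- The support of a variation. -/
def variationSupport {n : ℕ} (I : Set ℝ) (γ : ℝ → Ambient n) (ε : ℝ) (g : ℝ → ℝ → Ambient n) :
    Set ℝ :=
  closure {t | t ∈ I ∧ ∃ τ ∈ Set.Ioo (-ε) ε, g t τ ≠ γ t}

/-- `γ` is a conformal world-line: the derivative at `τ = 0` of the total strain over `K = [a, b]`
exists and vanishes, for all smooth variations supported in `K ⊆ I`. (When `γ` is generic and
time-like, then so is `γ_τ` for all small `τ`, since `K` is compact.) -/
def IsConformalWorldLine {n : ℕ} (I : Set ℝ) (γ : ℝ → Ambient n) : Prop :=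
  ∀ a b : ℝ, a ≤ b → Set.Icc a b ⊆ I →
    ∀ (ε : ℝ) (g : ℝ → ℝ → Ambient n), IsVariation I γ ε g →
      variationSupport I γ ε g ⊆ Set.Icc a b →
        HasDerivAt (fun τ => totalStrain a b (fun t => g t τ)) 0 0

end ConformalStrain

open scoped ContDiff

namespace ConformalStrain

/-! Dots are derivatives with respect to the arc element `υ dt`, with υ the strain density of γ, and
c = ⟨Γ̈,Γ̈⟩. The main device is to lift all curves γ_τ of a variation by the null-lift that has unit
speed for the fixed arc element of γ (`unitLift`), and not by their own canonical lifts. Since the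
strain does not depend on the null-lift, the strain of γ_τ is υ⁴F_τ, where F = ⟨Γ⃛,Γ⃛⟩ + c² is
computed with this lift (`strain_eq_strainFactor`). The density of γ_τ is therefore υF_τ^{1/4}, and
F_0 = 1. As υ is independent of τ, the τ-derivative commutes with the dot. If V is the τ-derivative
of the lifts at τ = 0, the density varies at the rate ½υ(⟨Γ⃛,V⃛⟩ + 2c⟨Γ̈,V̈⟩).

The field V satisfies the linearized constraints ⟨Γ,V⟩ = 0 and ⟨Γ̇,V̇⟩ = 0. Integration by parts
leads to the momentum X = Γ⁗ - 2cΓ̈, and the frame equations give Ẍ = W + (EΓ̇)˙ + δΓ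
(`arcDeriv_arcDeriv_strainMomentum`). Here E and δ act as Lagrange multipliers of the two
constraints: paired with V, the term in E is an exact derivative and the term in δ is zero. So the
bracket above equals Ḃ - ⟨W,V⟩ for an explicit B (`hasArcDerivAt_boundaryTerm`). B vanishes at the
ends of K, and the derivative of the total strain at τ = 0 is -½∫ υ⟨W,V⟩ dt
(`hasDerivAt_totalStrain`). The section W is W_γ (`Wsec_eqOn`).

Hence W_γ = 0 is sufficient. For necessity, W lies in the second normal space, which is positive
definite (`eq_zero_of_orthogonal`). Cut off by a bump function and corrected by a multiple of γ, it
is the velocity of an admissible variation, and this variation has a nonzero first derivative unless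
W vanishes (`strainGradient_eq_zero`). -/

/-! ### Calculus with respect to an arc element -/

/-- The derivative `υ⁻¹ d/dt` with respect to the arc element `υ dt`. -/
noncomputable def arcDeriv {F : Type*} [NormedAddCommGroup F] [NormedSpace ℝ F]
    (υ : ℝ → ℝ) (f : ℝ → F) (t : ℝ) : F :=
  (υ t)⁻¹ • deriv f t

/-- The iterated derivatives with respect to the arc element `υ dt`. -/
noncomputable def arcDerivIter {F : Type*} [NormedAddCommGroup F] [NormedSpace ℝ F]
    (υ : ℝ → ℝ) (f : ℝ → F) : ℕ → ℝ → F
  | 0 => f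
  | k + 1 => arcDeriv υ (arcDerivIter υ f k)

section ArcDeriv

variable {F : Type*} [NormedAddCommGroup F] [NormedSpace ℝ F]

theorem arcDeriv_of_hasDerivAt {υ : ℝ → ℝ} {f : ℝ → F} {f' : F} {t : ℝ} (h : HasDerivAt f f' t) :
    arcDeriv υ f t = (υ t)⁻¹ • f' := by
  rw [arcDeriv, h.deriv]

theorem hasDerivAt_of_contDiffOn {f : ℝ → F} {I : Set ℝ} (hI : IsOpen I)
    (hf : ContDiffOn ℝ ∞ f I) {t : ℝ} (ht : t ∈ I) : HasDerivAt f (deriv f t) t :=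
  ((hf.differentiableOn (by simp)).differentiableAt (hI.mem_nhds ht)).hasDerivAt

theorem hasDerivAt_arcDeriv {υ : ℝ → ℝ} {f : ℝ → F} {I : Set ℝ} (hI : IsOpen I)
    (h0 : ∀ t ∈ I, 0 < υ t) (hf : ContDiffOn ℝ ∞ f I) {t : ℝ} (ht : t ∈ I) :
    HasDerivAt f (υ t • arcDeriv υ f t) t := by
  rw [arcDeriv, smul_inv_smul₀ (h0 t ht).ne']
  exact hasDerivAt_of_contDiffOn hI hf ht

theorem contDiffOn_arcDeriv {υ : ℝ → ℝ} {f : ℝ → F} {I : Set ℝ} (hI : IsOpen I)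
    (hυ : ContDiffOn ℝ ∞ υ I) (h0 : ∀ t ∈ I, 0 < υ t) (hf : ContDiffOn ℝ ∞ f I) :
    ContDiffOn ℝ ∞ (arcDeriv υ f) I :=
  (hυ.inv fun t ht => (h0 t ht).ne').smul ((contDiffOn_infty_iff_deriv_of_isOpen hI).1 hf).2

theorem contDiffOn_arcDerivIter {υ : ℝ → ℝ} {f : ℝ → F} {I : Set ℝ} (hI : IsOpen I)
    (hυ : ContDiffOn ℝ ∞ υ I) (h0 : ∀ t ∈ I, 0 < υ t) (hf : ContDiffOn ℝ ∞ f I) (k : ℕ) :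
    ContDiffOn ℝ ∞ (arcDerivIter υ f k) I := by
  induction k with
  | zero => exact hf
  | succ k ih => exact contDiffOn_arcDeriv hI hυ h0 ih

theorem arcDeriv_congr {υ : ℝ → ℝ} {f g : ℝ → F} {I : Set ℝ} (hI : IsOpen I)
    (h : Set.EqOn f g I) : Set.EqOn (arcDeriv υ f) (arcDeriv υ g) I := fun t ht => by
  rw [arcDeriv, arcDeriv, (h.eventuallyEq_of_mem (hI.mem_nhds ht)).deriv_eq]

theorem arcDerivIter_congr {υ : ℝ → ℝ} {f g : ℝ → F} {I : Set ℝ} (hI : IsOpen I)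
    (h : Set.EqOn f g I) (k : ℕ) : Set.EqOn (arcDerivIter υ f k) (arcDerivIter υ g k) I := by
  induction k with
  | zero => exact h
  | succ k ih => exact arcDeriv_congr hI ih

theorem arcDeriv_eq_zero_of_eqOn_const {υ : ℝ → ℝ} {f : ℝ → F} {I : Set ℝ} (hI : IsOpen I) {x : F}
    (h : Set.EqOn f (fun _ => x) I) {t : ℝ} (ht : t ∈ I) : arcDeriv υ f t = 0 := by
  rw [arcDeriv_congr hI h ht, arcDeriv, deriv_const, smul_zero]

/-- `f` has the derivative `f'` at `t` with respect to the arc element `υ dt`. -/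
def HasArcDerivAt (υ : ℝ → ℝ) (f : ℝ → F) (f' : F) (t : ℝ) : Prop :=
  HasDerivAt f (υ t • f') t

/-- Because the predicate absorbs the factor υ, the sum and product rules below are free of υ.
Positivity of υ is needed only for passing to and from `arcDeriv` and for uniqueness. -/
theorem HasArcDerivAt.arcDeriv_eq {υ : ℝ → ℝ} {f : ℝ → F} {f' : F} {t : ℝ}
    (h : HasArcDerivAt υ f f' t) (h0 : 0 < υ t) : arcDeriv υ f t = f' := by
  rw [arcDeriv_of_hasDerivAt h, inv_smul_smul₀ h0.ne']

theorem hasArcDerivAt_of_contDiffOn {υ : ℝ → ℝ} {f : ℝ → F} {I : Set ℝ} (hI : IsOpen I)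
    (h0 : ∀ t ∈ I, 0 < υ t) (hf : ContDiffOn ℝ ∞ f I) {t : ℝ} (ht : t ∈ I) :
    HasArcDerivAt υ f (arcDeriv υ f t) t :=
  hasDerivAt_arcDeriv hI h0 hf ht

theorem HasArcDerivAt.add {υ : ℝ → ℝ} {f g : ℝ → F} {f' g' : F} {t : ℝ}
    (hf : HasArcDerivAt υ f f' t) (hg : HasArcDerivAt υ g g' t) :
    HasArcDerivAt υ (fun s => f s + g s) (f' + g') t :=
  (HasDerivAt.fun_add hf hg).congr_deriv (smul_add _ _ _).symm

theorem HasArcDerivAt.sub {υ : ℝ → ℝ} {f g : ℝ → F} {f' g' : F} {t : ℝ}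
    (hf : HasArcDerivAt υ f f' t) (hg : HasArcDerivAt υ g g' t) :
    HasArcDerivAt υ (fun s => f s - g s) (f' - g') t :=
  (HasDerivAt.fun_sub hf hg).congr_deriv (smul_sub _ _ _).symm

theorem HasArcDerivAt.smul {υ r : ℝ → ℝ} {f : ℝ → F} {r' : ℝ} {f' : F} {t : ℝ}
    (hr : HasArcDerivAt υ r r' t) (hf : HasArcDerivAt υ f f' t) :
    HasArcDerivAt υ (fun s => r s • f s) (r' • f t + r t • f') t :=
  (HasDerivAt.fun_smul hr hf).congr_deriv (by simp only [smul_eq_mul]; module)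

theorem HasArcDerivAt.mul {υ r f : ℝ → ℝ} {r' f' t : ℝ}
    (hr : HasArcDerivAt υ r r' t) (hf : HasArcDerivAt υ f f' t) :
    HasArcDerivAt υ (fun s => r s * f s) (r' * f t + r t * f') t :=
  hr.smul hf

theorem HasArcDerivAt.const_mul {υ f : ℝ → ℝ} {f' t : ℝ} (x : ℝ)
    (hf : HasArcDerivAt υ f f' t) : HasArcDerivAt υ (fun s => x * f s) (x * f') t :=
  (HasDerivAt.const_mul x hf).congr_deriv (by simp only [smul_eq_mul]; ring)

theorem hasArcDerivAt_const {υ : ℝ → ℝ} (x : F) (t : ℝ) :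
    HasArcDerivAt υ (fun _ => x) 0 t :=
  (hasDerivAt_const t x).congr_deriv (smul_zero _).symm

theorem HasArcDerivAt.scalarProduct {n : ℕ} {υ : ℝ → ℝ} {f g : ℝ → Ambient n} {f' g' : Ambient n}
    {t : ℝ} (hf : HasArcDerivAt υ f f' t) (hg : HasArcDerivAt υ g g' t) :
    HasArcDerivAt υ (fun s => ConformalStrain.scalarProduct n (f s) (g s))
      (ConformalStrain.scalarProduct n f' (g t) + ConformalStrain.scalarProduct n (f t) g') t :=
  (hasDerivAt_scalarProduct hf hg).congr_deriv
    (by simp only [map_smul, LinearMap.smul_apply, smul_eq_mul]; ring)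

theorem HasArcDerivAt.unique_of_eqOn {υ : ℝ → ℝ} {f g : ℝ → F} {f' g' : F} {I : Set ℝ}
    (hI : IsOpen I) (h : Set.EqOn f g I) {t : ℝ} (ht : t ∈ I) (h0 : 0 < υ t)
    (hf : HasArcDerivAt υ f f' t) (hg : HasArcDerivAt υ g g' t) : f' = g' :=
  smul_right_injective F h0.ne' (hasDerivAt_unique_of_eqOn hI h ht hf hg)

end ArcDeriv

theorem dot_eq_arcDeriv {n : ℕ} {F : Type*} [NormedAddCommGroup F] [NormedSpace ℝ F]
    (γ : ℝ → Ambient n) (f : ℝ → F) : dot γ f = arcDeriv (strainDensity γ) f := rfl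

/-! ### Scalar products among the arc derivatives of a unit lift -/

/-- `Γ` is a null curve on the light cone whose derivative with respect to the arc element `υ dt`
is a time-like unit vector. -/
structure IsUnitLift {n : ℕ} (I : Set ℝ) (υ : ℝ → ℝ) (Γ : ℝ → Ambient n) : Prop where
  weight_smooth : ContDiffOn ℝ ∞ υ I
  weight_pos : ∀ t ∈ I, 0 < υ t
  smooth : ContDiffOn ℝ ∞ Γ I
  null : ∀ t ∈ I, scalarProduct n (Γ t) (Γ t) = 0
  unit : ∀ t ∈ I, scalarProduct n (arcDeriv υ Γ t) (arcDeriv υ Γ t) = -1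

namespace IsUnitLift

variable {n : ℕ} {I : Set ℝ} {υ : ℝ → ℝ} {Γ : ℝ → Ambient n}

theorem contDiffOn_iter (h : IsUnitLift I υ Γ) (hI : IsOpen I) (k : ℕ) :
    ContDiffOn ℝ ∞ (arcDerivIter υ Γ k) I :=
  contDiffOn_arcDerivIter hI h.weight_smooth h.weight_pos h.smooth k

theorem hasArcDerivAt (h : IsUnitLift I υ Γ) (hI : IsOpen I) {F : Type*} [NormedAddCommGroup F]
    [NormedSpace ℝ F] {f : ℝ → F} (hf : ContDiffOn ℝ ∞ f I) {t : ℝ} (ht : t ∈ I) :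
    HasArcDerivAt υ f (arcDeriv υ f t) t :=
  hasArcDerivAt_of_contDiffOn hI h.weight_pos hf ht

theorem hasArcDerivAt_iter (h : IsUnitLift I υ Γ) (hI : IsOpen I) (k : ℕ) {t : ℝ} (ht : t ∈ I) :
    HasArcDerivAt υ (arcDerivIter υ Γ k) (arcDerivIter υ Γ (k + 1) t) t :=
  h.hasArcDerivAt hI (h.contDiffOn_iter hI k) ht

/-- The engine of this part: each relation between scalar products comes from differentiating an
earlier relation that holds on all of the open set I. -/
theorem differentiate (h : IsUnitLift I υ Γ) (hI : IsOpen I) {f : ℝ → ℝ} {x f' : ℝ}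
    (hf : ∀ t ∈ I, f t = x) {t : ℝ} (ht : t ∈ I) (hf' : HasArcDerivAt υ f f' t) : f' = 0 :=
  HasArcDerivAt.unique_of_eqOn hI (g := fun _ => x) hf ht (h.weight_pos t ht) hf'
    (hasArcDerivAt_const x t)

theorem inner_zero_one (h : IsUnitLift I υ Γ) (hI : IsOpen I) {t : ℝ} (ht : t ∈ I) :
    scalarProduct n (arcDerivIter υ Γ 0 t) (arcDerivIter υ Γ 1 t) = 0 := by
  have := h.differentiate hI h.null ht
    ((h.hasArcDerivAt_iter hI 0 ht).scalarProduct (h.hasArcDerivAt_iter hI 0 ht))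
  rw [scalarProduct_comm (arcDerivIter υ Γ (0 + 1) t)] at this
  change scalarProduct n (arcDerivIter υ Γ 0 t) (arcDerivIter υ Γ 1 t) +
    scalarProduct n (arcDerivIter υ Γ 0 t) (arcDerivIter υ Γ 1 t) = 0 at this
  linarith

theorem inner_zero_two (h : IsUnitLift I υ Γ) (hI : IsOpen I) {t : ℝ} (ht : t ∈ I) :
    scalarProduct n (arcDerivIter υ Γ 0 t) (arcDerivIter υ Γ 2 t) = 1 := by
  have := h.differentiate hI (fun s hs => h.inner_zero_one hI hs) ht
    ((h.hasArcDerivAt_iter hI 0 ht).scalarProduct (h.hasArcDerivAt_iter hI 1 ht))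
  have h1 := h.unit t ht
  simp only [zero_add, one_add_one_eq_two] at this
  change scalarProduct n (arcDerivIter υ Γ 1 t) (arcDerivIter υ Γ 1 t) = -1 at h1
  linarith

theorem inner_one_two (h : IsUnitLift I υ Γ) (hI : IsOpen I) {t : ℝ} (ht : t ∈ I) :
    scalarProduct n (arcDerivIter υ Γ 1 t) (arcDerivIter υ Γ 2 t) = 0 := by
  have := h.differentiate hI h.unit ht
    ((h.hasArcDerivAt_iter hI 1 ht).scalarProduct (h.hasArcDerivAt_iter hI 1 ht))
  rw [scalarProduct_comm (arcDerivIter υ Γ (1 + 1) t)] at this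
  simp only [one_add_one_eq_two] at this
  change scalarProduct n (arcDerivIter υ Γ 1 t) (arcDerivIter υ Γ 2 t) +
    scalarProduct n (arcDerivIter υ Γ 1 t) (arcDerivIter υ Γ 2 t) = 0 at this
  linarith

theorem inner_zero_three (h : IsUnitLift I υ Γ) (hI : IsOpen I) {t : ℝ} (ht : t ∈ I) :
    scalarProduct n (arcDerivIter υ Γ 0 t) (arcDerivIter υ Γ 3 t) = 0 := by
  have := h.differentiate hI (fun s hs => h.inner_zero_two hI hs) ht
    ((h.hasArcDerivAt_iter hI 0 ht).scalarProduct (h.hasArcDerivAt_iter hI 2 ht))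
  have h1 := h.inner_one_two hI ht
  simp only [zero_add, two_add_one_eq_three] at this
  linarith

theorem inner_one_three (h : IsUnitLift I υ Γ) (hI : IsOpen I) {t : ℝ} (ht : t ∈ I) :
    scalarProduct n (arcDerivIter υ Γ 1 t) (arcDerivIter υ Γ 3 t) =
      -scalarProduct n (arcDerivIter υ Γ 2 t) (arcDerivIter υ Γ 2 t) := by
  have := h.differentiate hI (fun s hs => h.inner_one_two hI hs) ht
    ((h.hasArcDerivAt_iter hI 1 ht).scalarProduct (h.hasArcDerivAt_iter hI 2 ht))
  simp only [one_add_one_eq_two, two_add_one_eq_three] at this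
  linarith

theorem hasArcDerivAt_inner_two_two (h : IsUnitLift I υ Γ) (hI : IsOpen I) {t : ℝ} (ht : t ∈ I) :
    HasArcDerivAt υ (fun s => scalarProduct n (arcDerivIter υ Γ 2 s) (arcDerivIter υ Γ 2 s))
      (2 * scalarProduct n (arcDerivIter υ Γ 2 t) (arcDerivIter υ Γ 3 t)) t := by
  have := (h.hasArcDerivAt_iter hI 2 ht).scalarProduct (h.hasArcDerivAt_iter hI 2 ht)
  rwa [scalarProduct_comm (arcDerivIter υ Γ (2 + 1) t), ← two_mul] at this

end IsUnitLift

/-! ### Osculating spaces, normal projections and strain of a unit lift -/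

/-- The component of the third arc derivative of a unit lift normal to the second osculating
space. -/
noncomputable def thirdNormal {n : ℕ} (υ : ℝ → ℝ) (Γ : ℝ → Ambient n) (t : ℝ) : Ambient n :=
  arcDerivIter υ Γ 3 t -
    scalarProduct n (arcDerivIter υ Γ 2 t) (arcDerivIter υ Γ 2 t) • arcDerivIter υ Γ 1 t -
    scalarProduct n (arcDerivIter υ Γ 2 t) (arcDerivIter υ Γ 3 t) • Γ t

/-- The square of the length of `thirdNormal`, when `Γ` is a unit lift. -/
noncomputable def strainFactor {n : ℕ} (υ : ℝ → ℝ) (Γ : ℝ → Ambient n) (t : ℝ) : ℝ :=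
  scalarProduct n (arcDerivIter υ Γ 3 t) (arcDerivIter υ Γ 3 t) +
    scalarProduct n (arcDerivIter υ Γ 2 t) (arcDerivIter υ Γ 2 t) ^ 2

/-- The osculating spaces formed with arc derivatives. -/
def arcOsculatingSpace {n : ℕ} (υ : ℝ → ℝ) (k : ℕ) (Γ : ℝ → Ambient n) (t : ℝ) :
    Submodule ℝ (Ambient n) :=
  Submodule.span ℝ {V | ∃ j ≤ k, V = arcDerivIter υ Γ j t}

namespace IsUnitLift

variable {n : ℕ} {I : Set ℝ} {υ : ℝ → ℝ} {Γ : ℝ → Ambient n}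

theorem iteratedDeriv_one_eq (h : IsUnitLift I υ Γ) :
    ∀ t ∈ I, iteratedDeriv 1 Γ t = υ t • arcDerivIter υ Γ 1 t := by
  intro t ht
  rw [iteratedDeriv_one]
  exact (smul_inv_smul₀ (h.weight_pos t ht).ne' _).symm

theorem iteratedDeriv_two_eq (h : IsUnitLift I υ Γ) (hI : IsOpen I) :
    ∀ t ∈ I, iteratedDeriv 2 Γ t =
      deriv υ t • arcDerivIter υ Γ 1 t + (υ t ^ 2) • arcDerivIter υ Γ 2 t := by
  intro t ht
  rw [hasDerivAt_unique_of_eqOn hI h.iteratedDeriv_one_eq ht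
    (hasDerivAt_iteratedDeriv hI h.smooth 1 ht)
    ((hasDerivAt_of_contDiffOn hI h.weight_smooth ht).fun_smul (h.hasArcDerivAt_iter hI 1 ht))]
  module

theorem iteratedDeriv_three_eq (h : IsUnitLift I υ Γ) (hI : IsOpen I) :
    ∀ t ∈ I, iteratedDeriv 3 Γ t =
      deriv (deriv υ) t • arcDerivIter υ Γ 1 t + (3 * υ t * deriv υ t) • arcDerivIter υ Γ 2 t +
        (υ t ^ 3) • arcDerivIter υ Γ 3 t := by
  intro t ht
  have h1 := hasDerivAt_of_contDiffOn hI h.weight_smooth ht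
  have h2 := hasDerivAt_of_contDiffOn hI
    ((contDiffOn_infty_iff_deriv_of_isOpen hI).1 h.weight_smooth).2 ht
  rw [hasDerivAt_unique_of_eqOn hI (h.iteratedDeriv_two_eq hI) ht
    (hasDerivAt_iteratedDeriv hI h.smooth 2 ht)
    ((h2.fun_smul (h.hasArcDerivAt_iter hI 1 ht)).fun_add
      ((h1.fun_pow 2).fun_smul (h.hasArcDerivAt_iter hI 2 ht)))]
  simp only [one_add_one_eq_two, two_add_one_eq_three]
  push_cast
  module

/-- The passage from t-derivatives to arc derivatives is triangular, with powers of υ on the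
diagonal, so it is invertible. The projections involve only the cases k = 2 and k = 3. -/
theorem osculatingSpace_eq (h : IsUnitLift I υ Γ) (hI : IsOpen I) {k : ℕ} (hk : k ≤ 3) {t : ℝ}
    (ht : t ∈ I) : osculatingSpace k Γ t = arcOsculatingSpace υ k Γ t := by
  have h0 := h.weight_pos t ht
  have e1 := h.iteratedDeriv_one_eq t ht
  have e2 := h.iteratedDeriv_two_eq hI t ht
  have e3 := h.iteratedDeriv_three_eq hI t ht
  apply le_antisymm
  · refine Submodule.span_le.2 ?_
    rintro V ⟨j, hj, rfl⟩
    have m (i : ℕ) (hi : i ≤ k) : arcDerivIter υ Γ i t ∈ arcOsculatingSpace υ k Γ t :=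
      Submodule.subset_span ⟨i, hi, rfl⟩
    have hj3 := hj.trans hk
    rw [SetLike.mem_coe]
    interval_cases j
    · exact m 0 hj
    · rw [e1]
      exact Submodule.smul_mem _ _ (m 1 hj)
    · rw [e2]
      exact add_mem (Submodule.smul_mem _ _ (m 1 (by omega))) (Submodule.smul_mem _ _ (m 2 hj))
    · rw [e3]
      exact add_mem (add_mem (Submodule.smul_mem _ _ (m 1 (by omega)))
        (Submodule.smul_mem _ _ (m 2 (by omega)))) (Submodule.smul_mem _ _ (m 3 hj))
  · refine Submodule.span_le.2 ?_
    rintro V ⟨j, hj, rfl⟩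
    set T := osculatingSpace k Γ t
    have m (i : ℕ) (hi : i ≤ k) : iteratedDeriv i Γ t ∈ T := Submodule.subset_span ⟨i, hi, rfl⟩
    have n1 (hi : 1 ≤ k) : arcDerivIter υ Γ 1 t ∈ T := by
      have := m 1 hi
      rw [e1] at this
      exact (T.smul_mem_iff h0.ne').1 this
    have n2 (hi : 2 ≤ k) : arcDerivIter υ Γ 2 t ∈ T := by
      have := m 2 hi
      rw [e2] at this
      exact (T.smul_mem_iff (pow_pos h0 2).ne').1
        ((T.add_mem_iff_right (T.smul_mem _ (n1 (by omega)))).1 this)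
    have n3 (hi : 3 ≤ k) : arcDerivIter υ Γ 3 t ∈ T := by
      have := m 3 hi
      rw [e3] at this
      exact (T.smul_mem_iff (pow_pos h0 3).ne').1
        ((T.add_mem_iff_right (add_mem (T.smul_mem _ (n1 (by omega)))
          (T.smul_mem _ (n2 (by omega))))).1 this)
    have hj3 := hj.trans hk
    rw [SetLike.mem_coe]
    interval_cases j
    · exact m 0 hj
    · exact n1 hj
    · exact n2 hj
    · exact n3 hj

theorem osculatingSpace_two_eq (h : IsUnitLift I υ Γ) (hI : IsOpen I) {t : ℝ} (ht : t ∈ I) :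
    osculatingSpace 2 Γ t =
      Submodule.span ℝ {arcDerivIter υ Γ 0 t, arcDerivIter υ Γ 1 t, arcDerivIter υ Γ 2 t} := by
  rw [h.osculatingSpace_eq hI (by simp) ht, arcOsculatingSpace]
  congr 1
  ext V
  simp only [Set.mem_ofPred_eq, Set.mem_insert_iff, Set.mem_singleton_iff]
  constructor
  · rintro ⟨j, hj, rfl⟩
    interval_cases j <;> simp
  · rintro (rfl | rfl | rfl)
    · exact ⟨0, by simp⟩
    · exact ⟨1, by simp⟩
    · exact ⟨2, by simp⟩

/-- Trading Γ⃛ for its normal component N makes the extra generator orthogonal to the second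
osculating space. Orthogonality to the third osculating space can then be tested on N and on the
second one separately. -/
theorem osculatingSpace_three_eq (h : IsUnitLift I υ Γ) (hI : IsOpen I) {t : ℝ} (ht : t ∈ I) :
    osculatingSpace 3 Γ t = Submodule.span ℝ {thirdNormal υ Γ t, arcDerivIter υ Γ 0 t,
      arcDerivIter υ Γ 1 t, arcDerivIter υ Γ 2 t} := by
  rw [h.osculatingSpace_eq hI le_rfl ht]
  apply le_antisymm
  · refine Submodule.span_le.2 ?_
    rintro V ⟨j, hj, rfl⟩
    rw [SetLike.mem_coe]
    set T := Submodule.span ℝ {thirdNormal υ Γ t, arcDerivIter υ Γ 0 t,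
      arcDerivIter υ Γ 1 t, arcDerivIter υ Γ 2 t}
    have mN : thirdNormal υ Γ t ∈ T := Submodule.subset_span (by simp)
    have m0 : arcDerivIter υ Γ 0 t ∈ T := Submodule.subset_span (by simp)
    have m1 : arcDerivIter υ Γ 1 t ∈ T := Submodule.subset_span (by simp)
    have m2 : arcDerivIter υ Γ 2 t ∈ T := Submodule.subset_span (by simp)
    interval_cases j
    · exact m0
    · exact m1
    · exact m2
    · exact (T.sub_mem_iff_left (T.smul_mem _ m1)).1 ((T.sub_mem_iff_left (T.smul_mem _ m0)).1 mN)
  · have m (i : ℕ) (hi : i ≤ 3) : arcDerivIter υ Γ i t ∈ arcOsculatingSpace υ 3 Γ t :=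
      Submodule.subset_span ⟨i, hi, rfl⟩
    refine Submodule.span_le.2 ?_
    rintro V (rfl | rfl | rfl | rfl)
    · exact sub_mem (sub_mem (m 3 le_rfl) (Submodule.smul_mem _ _ (m 1 (by simp))))
        (Submodule.smul_mem _ _ (m 0 (by simp)))
    · exact m 0 (by simp)
    · exact m 1 (by simp)
    · exact m 2 (by simp)

theorem inner_zero_thirdNormal (h : IsUnitLift I υ Γ) (hI : IsOpen I) {t : ℝ} (ht : t ∈ I) :
    scalarProduct n (arcDerivIter υ Γ 0 t) (thirdNormal υ Γ t) = 0 := by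
  have h0 := h.null t ht
  change scalarProduct n (arcDerivIter υ Γ 0 t) (arcDerivIter υ Γ 0 t) = 0 at h0
  change scalarProduct n _ (_ - _ - _ • arcDerivIter υ Γ 0 t) = 0
  simp only [map_sub, map_smul, smul_eq_mul, h.inner_zero_three hI ht, h.inner_zero_one hI ht, h0]
  ring

theorem inner_one_thirdNormal (h : IsUnitLift I υ Γ) (hI : IsOpen I) {t : ℝ} (ht : t ∈ I) :
    scalarProduct n (arcDerivIter υ Γ 1 t) (thirdNormal υ Γ t) = 0 := by
  have h1 := h.unit t ht
  change scalarProduct n (arcDerivIter υ Γ 1 t) (arcDerivIter υ Γ 1 t) = -1 at h1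
  change scalarProduct n _ (_ - _ - _ • arcDerivIter υ Γ 0 t) = 0
  simp only [map_sub, map_smul, smul_eq_mul, h.inner_one_three hI ht,
    scalarProduct_comm (arcDerivIter υ Γ 1 t) (arcDerivIter υ Γ 0 t), h.inner_zero_one hI ht, h1]
  ring

theorem inner_two_thirdNormal (h : IsUnitLift I υ Γ) (hI : IsOpen I) {t : ℝ} (ht : t ∈ I) :
    scalarProduct n (arcDerivIter υ Γ 2 t) (thirdNormal υ Γ t) = 0 := by
  change scalarProduct n _ (_ - _ - _ • arcDerivIter υ Γ 0 t) = 0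
  simp only [map_sub, map_smul, smul_eq_mul,
    scalarProduct_comm (arcDerivIter υ Γ 2 t) (arcDerivIter υ Γ 1 t), h.inner_one_two hI ht,
    scalarProduct_comm (arcDerivIter υ Γ 2 t) (arcDerivIter υ Γ 0 t), h.inner_zero_two hI ht]
  ring

theorem inner_three_thirdNormal (h : IsUnitLift I υ Γ) (hI : IsOpen I) {t : ℝ} (ht : t ∈ I) :
    scalarProduct n (arcDerivIter υ Γ 3 t) (thirdNormal υ Γ t) = strainFactor υ Γ t := by
  change scalarProduct n _ (_ - _ - _ • arcDerivIter υ Γ 0 t) = _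
  simp only [map_sub, map_smul, smul_eq_mul, strainFactor,
    scalarProduct_comm (arcDerivIter υ Γ 3 t) (arcDerivIter υ Γ 1 t), h.inner_one_three hI ht,
    scalarProduct_comm (arcDerivIter υ Γ 3 t) (arcDerivIter υ Γ 0 t), h.inner_zero_three hI ht]
  ring

theorem thirdNormal_self (h : IsUnitLift I υ Γ) (hI : IsOpen I) {t : ℝ} (ht : t ∈ I) :
    scalarProduct n (thirdNormal υ Γ t) (thirdNormal υ Γ t) = strainFactor υ Γ t := by
  rw [← h.inner_three_thirdNormal hI ht]
  have h0 := h.inner_zero_thirdNormal hI ht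
  have h1 := h.inner_one_thirdNormal hI ht
  change scalarProduct n (Γ t) _ = 0 at h0
  generalize hN : thirdNormal υ Γ t = N at h0 h1 ⊢
  -- Only the left factor is expanded. N is orthogonal to Γ and Γ̇, so just ⟨Γ⃛,N⟩ survives.
  conv_lhs => enter [1, 2]; rw [← hN, thirdNormal]
  simp only [map_sub, map_smul, smul_eq_mul, LinearMap.sub_apply, LinearMap.smul_apply, h0, h1]
  ring

theorem isCompl_two (h : IsUnitLift I υ Γ) (hI : IsOpen I) {t : ℝ} (ht : t ∈ I) :
    IsCompl (normalSpace 2 Γ t) (osculatingSpace 2 Γ t) := by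
  have h1 : scalarProduct n (arcDerivIter υ Γ 1 t) (arcDerivIter υ Γ 1 t) = -1 := h.unit t ht
  rw [normalSpace, h.osculatingSpace_two_eq hI ht]
  exact (exists_projection (h.null t ht) (h.inner_zero_one hI ht)
    ((h.inner_zero_two hI ht).trans (by rw [h1, neg_neg])) (by rw [h1]; norm_num)).1

theorem normalProj_two (h : IsUnitLift I υ Γ) (hI : IsOpen I) {t : ℝ} (ht : t ∈ I) :
    normalProj 2 Γ t (arcDerivIter υ Γ 3 t) = thirdNormal υ Γ t := by
  refine normalProj_eq ?_ ?_ ?_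
  · exact h.isCompl_two hI ht
  · rw [normalSpace, h.osculatingSpace_two_eq hI ht, mem_orthogonal_span_triple]
    exact ⟨h.inner_zero_thirdNormal hI ht, h.inner_one_thirdNormal hI ht,
      h.inner_two_thirdNormal hI ht⟩
  · rw [h.osculatingSpace_two_eq hI ht]
    refine Submodule.mem_span_triple.2 ⟨scalarProduct n (arcDerivIter υ Γ 2 t)
      (arcDerivIter υ Γ 3 t), scalarProduct n (arcDerivIter υ Γ 2 t) (arcDerivIter υ Γ 2 t),
      0, ?_⟩
    change _ = arcDerivIter υ Γ 3 t - (arcDerivIter υ Γ 3 t - _ - _ • arcDerivIter υ Γ 0 t)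
    module

/-- Modulo the second osculating space Γ''' is υ³Γ⃛, whose normal part is υ³N. Its square υ⁶⟨N,N⟩ is
divided by |⟨Γ',Γ'⟩| = υ². -/
theorem strain_eq (h : IsUnitLift I υ Γ) (hI : IsOpen I) {t : ℝ} (ht : t ∈ I) :
    strain Γ t = υ t ^ 4 * strainFactor υ Γ t := by
  have h0 := h.weight_pos t ht
  have h1 : scalarProduct n (arcDerivIter υ Γ 1 t) (arcDerivIter υ Γ 1 t) = -1 := h.unit t ht
  have z (j : ℕ) (hj : j ≤ 2) : normalProj 2 Γ t (arcDerivIter υ Γ j t) = 0 := by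
    refine normalProj_eq_zero ?_
    rw [h.osculatingSpace_eq hI (by simp) ht]
    exact Submodule.subset_span ⟨j, hj, rfl⟩
  rw [strain, ← iteratedDeriv_one, h.iteratedDeriv_one_eq t ht, h.iteratedDeriv_three_eq hI t ht]
  simp only [map_add, map_smul, z 1 (by simp), z 2 le_rfl, smul_zero, zero_add,
    h.normalProj_two hI ht, LinearMap.smul_apply, smul_eq_mul, h.thirdNormal_self hI ht, h1]
  have : υ t * (υ t * -1) = -(υ t ^ 2) := by ring
  rw [this, abs_neg, abs_of_pos (pow_pos h0 2)]
  field_simp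

/-- The third osculating space is the orthogonal sum of the line of N, which is not null since ⟨N,N⟩
≠ 0, and of the second osculating space, on which the form is already known to be non-degenerate. -/
theorem isCompl_three (h : IsUnitLift I υ Γ) (hI : IsOpen I) {t : ℝ} (ht : t ∈ I)
    (hF : strainFactor υ Γ t ≠ 0) : IsCompl (normalSpace 3 Γ t) (osculatingSpace 3 Γ t) := by
  have hrefl : (scalarProduct n).IsRefl := fun x y hxy => by rw [scalarProduct_comm, hxy]
  refine IsCompl.symm ?_
  rw [normalSpace, LinearMap.BilinForm.isCompl_orthogonal_iff_disjoint hrefl,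
    Submodule.disjoint_def, h.osculatingSpace_three_eq hI ht]
  intro v hv hv'
  rw [LinearMap.BilinForm.mem_orthogonal_iff] at hv'
  obtain ⟨s, w, hw, rfl⟩ := Submodule.mem_span_insert.1 hv
  have hN : ∀ x ∈ Submodule.span ℝ {arcDerivIter υ Γ 0 t, arcDerivIter υ Γ 1 t,
      arcDerivIter υ Γ 2 t}, scalarProduct n x (thirdNormal υ Γ t) = 0 := by
    intro x hx
    obtain ⟨p, q, r, rfl⟩ := Submodule.mem_span_triple.1 hx
    simp [h.inner_zero_thirdNormal hI ht, h.inner_one_thirdNormal hI ht,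
      h.inner_two_thirdNormal hI ht]
  have hs : s = 0 := by
    have := hv' (thirdNormal υ Γ t) (Submodule.subset_span (by simp))
    rw [map_add, map_smul, h.thirdNormal_self hI ht,
      scalarProduct_comm _ w, hN w hw, add_zero, smul_eq_mul] at this
    exact (mul_eq_zero.1 this).resolve_right hF
  subst hs
  rw [zero_smul, zero_add] at hv' ⊢
  have hc := (h.isCompl_two hI ht).disjoint
  rw [normalSpace, h.osculatingSpace_two_eq hI ht] at hc
  refine Submodule.disjoint_def.1 hc w ?_ hw
  rw [LinearMap.BilinForm.mem_orthogonal_iff]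
  exact fun x hx => hv' x (Submodule.span_mono (Set.subset_insert _ _) hx)

/-- The osculating part is restricted to the span of N and Γ because this is where the derivatives
of N and of normal sections have theirs. -/
theorem normalProj_three (h : IsUnitLift I υ Γ) (hI : IsOpen I) {t : ℝ} (ht : t ∈ I)
    (hF : strainFactor υ Γ t ≠ 0) {V P : Ambient n}
    (h0 : scalarProduct n (arcDerivIter υ Γ 0 t) P = 0)
    (h1 : scalarProduct n (arcDerivIter υ Γ 1 t) P = 0)
    (h2 : scalarProduct n (arcDerivIter υ Γ 2 t) P = 0)
    (hN : scalarProduct n (thirdNormal υ Γ t) P = 0) (p q : ℝ)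
    (hV : V = P + p • thirdNormal υ Γ t + q • Γ t) : normalProj 3 Γ t V = P := by
  refine normalProj_eq (h.isCompl_three hI ht hF) ?_ ?_
  · rw [normalSpace, h.osculatingSpace_three_eq hI ht, LinearMap.BilinForm.mem_orthogonal_iff]
    intro x hx
    obtain ⟨s, w, hw, rfl⟩ := Submodule.mem_span_insert.1 hx
    obtain ⟨p, q, r, rfl⟩ := Submodule.mem_span_triple.1 hw
    simp [h0, h1, h2, hN]
  · rw [h.osculatingSpace_three_eq hI ht, hV]
    have m0 : Γ t ∈ Submodule.span ℝ {thirdNormal υ Γ t, arcDerivIter υ Γ 0 t,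
        arcDerivIter υ Γ 1 t, arcDerivIter υ Γ 2 t} :=
      Submodule.subset_span (by simp [arcDerivIter])
    rw [add_assoc, add_sub_cancel_left]
    exact add_mem (Submodule.smul_mem _ _ (Submodule.subset_span (by simp)))
      (Submodule.smul_mem _ _ m0)

end IsUnitLift

/-! ### Frame equations and the gradient section of an arc lift -/

/-- A unit lift for the weight given by the conformal arc element. -/
structure IsArcLift {n : ℕ} (I : Set ℝ) (υ : ℝ → ℝ) (Γ : ℝ → Ambient n) : Prop
    extends IsUnitLift I υ Γ where
  factor : ∀ t ∈ I, strainFactor υ Γ t = 1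

/-- The component of the derivative of `thirdNormal` in the third normal space. -/
noncomputable def torsionSec {n : ℕ} (υ : ℝ → ℝ) (Γ : ℝ → Ambient n) (t : ℝ) : Ambient n :=
  arcDeriv υ (thirdNormal υ Γ) t + Γ t

/-- The covariant derivative of a section of the third normal bundle. -/
noncomputable def normalDeriv {n : ℕ} (υ : ℝ → ℝ) (Γ P : ℝ → Ambient n) (t : ℝ) : Ambient n :=
  arcDeriv υ P t + scalarProduct n (torsionSec υ Γ t) (P t) • thirdNormal υ Γ t

/-- The gradient of the total strain, a section of the second normal bundle. -/
noncomputable def strainGradient {n : ℕ} (υ : ℝ → ℝ) (Γ : ℝ → Ambient n) (t : ℝ) : Ambient n :=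
  (-scalarProduct n (arcDerivIter υ Γ 2 t) (arcDerivIter υ Γ 3 t) -
      3 * scalarProduct n (torsionSec υ Γ t) (normalDeriv υ Γ (torsionSec υ Γ) t)) •
        thirdNormal υ Γ t -
    (scalarProduct n (torsionSec υ Γ t) (torsionSec υ Γ t) +
      scalarProduct n (arcDerivIter υ Γ 2 t) (arcDerivIter υ Γ 2 t)) • torsionSec υ Γ t +
    normalDeriv υ Γ (normalDeriv υ Γ (torsionSec υ Γ)) t

/-- `P` is a smooth section of the third normal bundle. -/
structure IsNormalSection {n : ℕ} (I : Set ℝ) (υ : ℝ → ℝ) (Γ P : ℝ → Ambient n) : Prop where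
  smooth : ContDiffOn ℝ ∞ P I
  zero : ∀ t ∈ I, scalarProduct n (arcDerivIter υ Γ 0 t) (P t) = 0
  one : ∀ t ∈ I, scalarProduct n (arcDerivIter υ Γ 1 t) (P t) = 0
  two : ∀ t ∈ I, scalarProduct n (arcDerivIter υ Γ 2 t) (P t) = 0
  third : ∀ t ∈ I, scalarProduct n (thirdNormal υ Γ t) (P t) = 0

/-- This is the structure equation for the derivative of Γ̈. With Ṅ = S - Γ and Ṗ = DP - ⟨S,P⟩N for
normal sections P it closes the system, and later identities reduce to comparing frame coefficients.
-/
theorem thirdNormal_eq {n : ℕ} (υ : ℝ → ℝ) (Γ : ℝ → Ambient n) (t : ℝ) :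
    arcDerivIter υ Γ 3 t = thirdNormal υ Γ t +
      scalarProduct n (arcDerivIter υ Γ 2 t) (arcDerivIter υ Γ 2 t) • arcDerivIter υ Γ 1 t +
      scalarProduct n (arcDerivIter υ Γ 2 t) (arcDerivIter υ Γ 3 t) • arcDerivIter υ Γ 0 t := by
  change _ = arcDerivIter υ Γ 3 t - _ - _ • arcDerivIter υ Γ 0 t + _ + _
  module

namespace IsArcLift

variable {n : ℕ} {I : Set ℝ} {υ : ℝ → ℝ} {Γ : ℝ → Ambient n}

theorem contDiffOn_arcDeriv (h : IsArcLift I υ Γ) (hI : IsOpen I) {F : Type*}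
    [NormedAddCommGroup F] [NormedSpace ℝ F] {f : ℝ → F} (hf : ContDiffOn ℝ ∞ f I) :
    ContDiffOn ℝ ∞ (arcDeriv υ f) I :=
  ConformalStrain.contDiffOn_arcDeriv hI h.weight_smooth h.weight_pos hf

theorem contDiffOn_thirdNormal (h : IsArcLift I υ Γ) (hI : IsOpen I) :
    ContDiffOn ℝ ∞ (thirdNormal υ Γ) I := by
  have s := h.contDiffOn_iter hI
  exact ((s 3).sub ((contDiffOn_scalarProduct (s 2) (s 2)).smul (s 1))).sub
    ((contDiffOn_scalarProduct (s 2) (s 3)).smul (s 0))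

theorem thirdNormal_unit (h : IsArcLift I υ Γ) (hI : IsOpen I) {t : ℝ} (ht : t ∈ I) :
    scalarProduct n (thirdNormal υ Γ t) (thirdNormal υ Γ t) = 1 := by
  rw [h.thirdNormal_self hI ht, h.factor t ht]

theorem arcDeriv_thirdNormal (t : ℝ) :
    arcDeriv υ (thirdNormal υ Γ) t = torsionSec υ Γ t - arcDerivIter υ Γ 0 t :=
  (add_sub_cancel_right _ _).symm

theorem hasArcDerivAt_thirdNormal (h : IsArcLift I υ Γ) (hI : IsOpen I) {t : ℝ} (ht : t ∈ I) :
    HasArcDerivAt υ (thirdNormal υ Γ) (torsionSec υ Γ t - arcDerivIter υ Γ 0 t) t := by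
  rw [← arcDeriv_thirdNormal]
  exact h.hasArcDerivAt hI (h.contDiffOn_thirdNormal hI) ht

/-- Differentiating the orthogonality relations of N shows that Ṅ is orthogonal to Γ, Γ̇ and N,
while ⟨Γ̈,Ṅ⟩ = -⟨Γ⃛,N⟩ = -F = -1. As ⟨Γ̈,Γ⟩ = 1, adding Γ cancels this last product. This is where
the normalization F = 1 enters. -/
theorem isNormalSection_torsionSec (h : IsArcLift I υ Γ) (hI : IsOpen I) :
    IsNormalSection I υ Γ (torsionSec υ Γ) where
  smooth := (h.contDiffOn_arcDeriv hI (h.contDiffOn_thirdNormal hI)).add h.smooth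
  zero t ht := by
    have := h.differentiate hI (fun s hs => h.inner_zero_thirdNormal hI hs) ht
      ((h.hasArcDerivAt_iter hI 0 ht).scalarProduct (h.hasArcDerivAt_thirdNormal hI ht))
    have e : scalarProduct n (arcDerivIter υ Γ 0 t) (arcDerivIter υ Γ 0 t) = 0 := h.null t ht
    simp only [zero_add, h.inner_one_thirdNormal hI ht, map_sub, e] at this
    linarith
  one t ht := by
    have := h.differentiate hI (fun s hs => h.inner_one_thirdNormal hI hs) ht
      ((h.hasArcDerivAt_iter hI 1 ht).scalarProduct (h.hasArcDerivAt_thirdNormal hI ht))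
    have e := h.inner_zero_one hI ht
    rw [scalarProduct_comm] at e
    simp only [one_add_one_eq_two, h.inner_two_thirdNormal hI ht, map_sub, e] at this
    linarith
  two t ht := by
    have := h.differentiate hI (fun s hs => h.inner_two_thirdNormal hI hs) ht
      ((h.hasArcDerivAt_iter hI 2 ht).scalarProduct (h.hasArcDerivAt_thirdNormal hI ht))
    have e := h.inner_zero_two hI ht
    rw [scalarProduct_comm] at e
    simp only [two_add_one_eq_three, h.inner_three_thirdNormal hI ht, map_sub, e,
      h.factor t ht] at this
    linarith
  third t ht := by
    have := h.differentiate hI (fun s hs => h.thirdNormal_unit hI hs) ht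
      ((h.hasArcDerivAt_thirdNormal hI ht).scalarProduct (h.hasArcDerivAt_thirdNormal hI ht))
    have e := h.inner_zero_thirdNormal hI ht
    simp only [map_sub, LinearMap.sub_apply, e,
      scalarProduct_comm (thirdNormal υ Γ t) (arcDerivIter υ Γ 0 t)] at this
    rw [scalarProduct_comm (torsionSec υ Γ t)] at this
    linarith

theorem hasArcDerivAt_normalSection (h : IsArcLift I υ Γ) (hI : IsOpen I) {P : ℝ → Ambient n}
    (hP : ContDiffOn ℝ ∞ P I) {t : ℝ} (ht : t ∈ I) :
    HasArcDerivAt υ P (normalDeriv υ Γ P t -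
      scalarProduct n (torsionSec υ Γ t) (P t) • thirdNormal υ Γ t) t := by
  rw [normalDeriv, add_sub_cancel_right]
  exact h.hasArcDerivAt hI hP ht

/-- Since P is orthogonal to Γ, Γ̇, Γ̈ and N, its derivative is orthogonal to Γ, Γ̇ and Γ̈, and
⟨N,Ṗ⟩ = -⟨Ṅ,P⟩ = -⟨S,P⟩. The added multiple of N removes exactly this component. -/
theorem isNormalSection_normalDeriv (h : IsArcLift I υ Γ) (hI : IsOpen I) {P : ℝ → Ambient n}
    (hP : IsNormalSection I υ Γ P) : IsNormalSection I υ Γ (normalDeriv υ Γ P) where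
  smooth := (h.contDiffOn_arcDeriv hI hP.smooth).add ((contDiffOn_scalarProduct
    (h.isNormalSection_torsionSec hI).smooth hP.smooth).smul (h.contDiffOn_thirdNormal hI))
  zero t ht := by
    have := h.differentiate hI hP.zero ht
      ((h.hasArcDerivAt_iter hI 0 ht).scalarProduct (h.hasArcDerivAt_normalSection hI hP.smooth ht))
    simp only [zero_add, map_sub, map_smul, h.inner_zero_thirdNormal hI ht, hP.one t ht] at this
    simpa using this
  one t ht := by
    have := h.differentiate hI hP.one ht
      ((h.hasArcDerivAt_iter hI 1 ht).scalarProduct (h.hasArcDerivAt_normalSection hI hP.smooth ht))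
    simp only [one_add_one_eq_two, map_sub, map_smul, h.inner_one_thirdNormal hI ht,
      hP.two t ht] at this
    simpa using this
  two t ht := by
    have := h.differentiate hI hP.two ht
      ((h.hasArcDerivAt_iter hI 2 ht).scalarProduct (h.hasArcDerivAt_normalSection hI hP.smooth ht))
    rw [two_add_one_eq_three, thirdNormal_eq] at this
    simp only [map_sub, map_add, map_smul, LinearMap.add_apply, LinearMap.smul_apply,
      h.inner_two_thirdNormal hI ht, hP.zero t ht, hP.one t ht, hP.third t ht] at this
    simpa using this
  third t ht := by
    have := h.differentiate hI hP.third ht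
      ((h.hasArcDerivAt_thirdNormal hI ht).scalarProduct
        (h.hasArcDerivAt_normalSection hI hP.smooth ht))
    simp only [map_sub, map_smul, LinearMap.sub_apply, h.thirdNormal_unit hI ht,
      hP.zero t ht] at this
    simpa using this

theorem contDiffOn_strainGradient (h : IsArcLift I υ Γ) (hI : IsOpen I) :
    ContDiffOn ℝ ∞ (strainGradient υ Γ) I := by
  have s := h.contDiffOn_iter hI
  have S := h.isNormalSection_torsionSec hI
  have DS := h.isNormalSection_normalDeriv hI S
  have DDS := h.isNormalSection_normalDeriv hI DS
  exact ((((contDiffOn_scalarProduct (s 2) (s 3)).neg.sub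
    (contDiffOn_const.mul (contDiffOn_scalarProduct S.smooth DS.smooth))).smul
      (h.contDiffOn_thirdNormal hI)).sub
    (((contDiffOn_scalarProduct S.smooth S.smooth).add
      (contDiffOn_scalarProduct (s 2) (s 2))).smul S.smooth)).add DDS.smooth

theorem inner_strainGradient (h : IsArcLift I υ Γ) (hI : IsOpen I) {t : ℝ} (ht : t ∈ I) :
    scalarProduct n (arcDerivIter υ Γ 0 t) (strainGradient υ Γ t) = 0 ∧
    scalarProduct n (arcDerivIter υ Γ 1 t) (strainGradient υ Γ t) = 0 ∧
    scalarProduct n (arcDerivIter υ Γ 2 t) (strainGradient υ Γ t) = 0 := by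
  have S := h.isNormalSection_torsionSec hI
  have DDS := h.isNormalSection_normalDeriv hI (h.isNormalSection_normalDeriv hI S)
  refine ⟨?_, ?_, ?_⟩ <;>
  simp [strainGradient, h.inner_zero_thirdNormal hI ht, h.inner_one_thirdNormal hI ht,
    h.inner_two_thirdNormal hI ht, S.zero t ht, S.one t ht, S.two t ht, DDS.zero t ht,
    DDS.one t ht, DDS.two t ht]

end IsArcLift

/-! ### Integration by parts in the first variation -/

/-- The momentum conjugate to the second derivative in the first variation of the total strain. -/
noncomputable def strainMomentum {n : ℕ} (υ : ℝ → ℝ) (Γ : ℝ → Ambient n) (t : ℝ) : Ambient n :=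
  arcDerivIter υ Γ 4 t -
    (2 * scalarProduct n (arcDerivIter υ Γ 2 t) (arcDerivIter υ Γ 2 t)) • arcDerivIter υ Γ 2 t

/-- The coefficient of `Γ̈` in the second derivative of the momentum. -/
noncomputable def strainEnergy {n : ℕ} (υ : ℝ → ℝ) (Γ : ℝ → Ambient n) (t : ℝ) : ℝ :=
  5 * arcDeriv υ (fun s => scalarProduct n (arcDerivIter υ Γ 2 s) (arcDerivIter υ Γ 3 s)) t - 1 -
    scalarProduct n (arcDerivIter υ Γ 2 t) (arcDerivIter υ Γ 2 t) *
      scalarProduct n (arcDerivIter υ Γ 2 t) (arcDerivIter υ Γ 2 t)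

/-- The boundary term in the first variation of the total strain. -/
noncomputable def boundaryTerm {n : ℕ} (υ : ℝ → ℝ) (Γ V : ℝ → Ambient n) (t : ℝ) : ℝ :=
  scalarProduct n (arcDerivIter υ Γ 3 t) (arcDerivIter υ V 2 t) -
    scalarProduct n (strainMomentum υ Γ t) (arcDerivIter υ V 1 t) +
    scalarProduct n (arcDeriv υ (strainMomentum υ Γ) t) (arcDerivIter υ V 0 t) -
    strainEnergy υ Γ t * scalarProduct n (arcDerivIter υ Γ 1 t) (arcDerivIter υ V 0 t)

namespace IsArcLift

variable {n : ℕ} {I : Set ℝ} {υ : ℝ → ℝ} {Γ : ℝ → Ambient n}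

theorem contDiffOn_strainMomentum (h : IsArcLift I υ Γ) (hI : IsOpen I) :
    ContDiffOn ℝ ∞ (strainMomentum υ Γ) I := by
  have s := h.contDiffOn_iter hI
  exact (s 4).sub ((contDiffOn_const.mul (contDiffOn_scalarProduct (s 2) (s 2))).smul (s 2))

theorem contDiffOn_inner_two_three (h : IsArcLift I υ Γ) (hI : IsOpen I) :
    ContDiffOn ℝ ∞ (fun s => scalarProduct n (arcDerivIter υ Γ 2 s) (arcDerivIter υ Γ 3 s)) I :=
  contDiffOn_scalarProduct (h.contDiffOn_iter hI 2) (h.contDiffOn_iter hI 3)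

/-- Γ⁗ is found by differentiating the structure equation Γ⃛ = N + cΓ̇ + gΓ, where g = ⟨Γ̈,Γ⃛⟩ and ċ
= 2g. -/
theorem strainMomentum_eq (h : IsArcLift I υ Γ) (hI : IsOpen I) {t : ℝ} (ht : t ∈ I) :
    strainMomentum υ Γ t = torsionSec υ Γ t - arcDerivIter υ Γ 0 t -
      scalarProduct n (arcDerivIter υ Γ 2 t) (arcDerivIter υ Γ 2 t) • arcDerivIter υ Γ 2 t +
      (3 * scalarProduct n (arcDerivIter υ Γ 2 t) (arcDerivIter υ Γ 3 t)) • arcDerivIter υ Γ 1 t +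
      arcDeriv υ (fun s => scalarProduct n (arcDerivIter υ Γ 2 s) (arcDerivIter υ Γ 3 s)) t •
        arcDerivIter υ Γ 0 t := by
  have e := HasArcDerivAt.unique_of_eqOn hI (fun s _ => thirdNormal_eq υ Γ s) ht
    (h.weight_pos t ht) (h.hasArcDerivAt_iter hI 3 ht)
    (((h.hasArcDerivAt_thirdNormal hI ht).add ((h.hasArcDerivAt_inner_two_two hI ht).smul
      (h.hasArcDerivAt_iter hI 1 ht))).add
      ((h.hasArcDerivAt hI (h.contDiffOn_inner_two_three hI) ht).smul
        (h.hasArcDerivAt_iter hI 0 ht)))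
  simp only [zero_add, one_add_one_eq_two, Nat.reduceAdd] at e
  rw [strainMomentum, e]
  module

theorem arcDeriv_strainMomentum (h : IsArcLift I υ Γ) (hI : IsOpen I) {t : ℝ} (ht : t ∈ I) :
    arcDeriv υ (strainMomentum υ Γ) t = normalDeriv υ Γ (torsionSec υ Γ) t -
      (scalarProduct n (torsionSec υ Γ t) (torsionSec υ Γ t) +
        scalarProduct n (arcDerivIter υ Γ 2 t) (arcDerivIter υ Γ 2 t)) • thirdNormal υ Γ t +
      scalarProduct n (arcDerivIter υ Γ 2 t) (arcDerivIter υ Γ 3 t) • arcDerivIter υ Γ 2 t +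
      (4 * arcDeriv υ
          (fun s => scalarProduct n (arcDerivIter υ Γ 2 s) (arcDerivIter υ Γ 3 s)) t - 1 -
        scalarProduct n (arcDerivIter υ Γ 2 t) (arcDerivIter υ Γ 2 t) *
          scalarProduct n (arcDerivIter υ Γ 2 t) (arcDerivIter υ Γ 2 t)) • arcDerivIter υ Γ 1 t +
      (arcDeriv υ (arcDeriv υ
          (fun s => scalarProduct n (arcDerivIter υ Γ 2 s) (arcDerivIter υ Γ 3 s))) t -
        scalarProduct n (arcDerivIter υ Γ 2 t) (arcDerivIter υ Γ 2 t) *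
          scalarProduct n (arcDerivIter υ Γ 2 t) (arcDerivIter υ Γ 3 t)) •
        arcDerivIter υ Γ 0 t := by
  have g := h.contDiffOn_inner_two_three hI
  have S := h.isNormalSection_torsionSec hI
  have e := HasArcDerivAt.unique_of_eqOn hI (fun s hs => h.strainMomentum_eq hI hs) ht
    (h.weight_pos t ht) (h.hasArcDerivAt hI (h.contDiffOn_strainMomentum hI) ht)
    (((((h.hasArcDerivAt_normalSection hI S.smooth ht).sub (h.hasArcDerivAt_iter hI 0 ht)).sub
      ((h.hasArcDerivAt_inner_two_two hI ht).smul (h.hasArcDerivAt_iter hI 2 ht))).add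
      (((h.hasArcDerivAt hI g ht).const_mul 3).smul (h.hasArcDerivAt_iter hI 1 ht))).add
      ((h.hasArcDerivAt hI (h.contDiffOn_arcDeriv hI g) ht).smul (h.hasArcDerivAt_iter hI 0 ht)))
  simp only [zero_add, one_add_one_eq_two, Nat.reduceAdd] at e
  have e3 := thirdNormal_eq υ Γ t
  set c := scalarProduct n (arcDerivIter υ Γ 2 t) (arcDerivIter υ Γ 2 t)
  set g := scalarProduct n (arcDerivIter υ Γ 2 t) (arcDerivIter υ Γ 3 t)
  rw [e3] at e
  rw [e]
  module

theorem hasArcDerivAt_strainEnergy (h : IsArcLift I υ Γ) (hI : IsOpen I) {t : ℝ} (ht : t ∈ I) :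
    HasArcDerivAt υ (strainEnergy υ Γ)
      (5 * arcDeriv υ (arcDeriv υ
          (fun s => scalarProduct n (arcDerivIter υ Γ 2 s) (arcDerivIter υ Γ 3 s))) t -
        4 * scalarProduct n (arcDerivIter υ Γ 2 t) (arcDerivIter υ Γ 2 t) *
          scalarProduct n (arcDerivIter υ Γ 2 t) (arcDerivIter υ Γ 3 t)) t := by
  have g := h.contDiffOn_inner_two_three hI
  have c := h.hasArcDerivAt_inner_two_two hI ht
  convert (show HasArcDerivAt υ (strainEnergy υ Γ) _ t from
    (((h.hasArcDerivAt hI (h.contDiffOn_arcDeriv hI g) ht).const_mul 5).sub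
      (hasArcDerivAt_const 1 t)).sub (c.mul c)) using 1
  ring

/-- The coefficient of Γ̇ turns out to be the derivative of the coefficient E of Γ̈. The two terms
therefore combine to (EΓ̇)˙, and the rest, apart from a multiple of Γ, is the gradient. -/
theorem arcDeriv_arcDeriv_strainMomentum (h : IsArcLift I υ Γ) (hI : IsOpen I) {t : ℝ}
    (ht : t ∈ I) : ∃ δ : ℝ, arcDeriv υ (arcDeriv υ (strainMomentum υ Γ)) t =
      strainGradient υ Γ t + strainEnergy υ Γ t • arcDerivIter υ Γ 2 t +
        arcDeriv υ (strainEnergy υ Γ) t • arcDerivIter υ Γ 1 t + δ • arcDerivIter υ Γ 0 t := by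
  have g := h.contDiffOn_inner_two_three hI
  have g' := h.contDiffOn_arcDeriv hI g
  have g'' := h.contDiffOn_arcDeriv hI g'
  have S := h.isNormalSection_torsionSec hI
  have DS := h.isNormalSection_normalDeriv hI S
  have dS := h.hasArcDerivAt_normalSection hI S.smooth ht
  have dc := h.hasArcDerivAt_inner_two_two hI ht
  have dg := h.hasArcDerivAt hI g ht
  have dg' := h.hasArcDerivAt hI g' ht
  have dg'' := h.hasArcDerivAt hI g'' ht
  have e := HasArcDerivAt.unique_of_eqOn hI (fun s hs => h.arcDeriv_strainMomentum hI hs) ht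
    (h.weight_pos t ht) (h.hasArcDerivAt hI
      (h.contDiffOn_arcDeriv hI (h.contDiffOn_strainMomentum hI)) ht)
    (((((h.hasArcDerivAt_normalSection hI DS.smooth ht).sub
      (((dS.scalarProduct dS).add dc).smul (h.hasArcDerivAt_thirdNormal hI ht))).add
      (dg.smul (h.hasArcDerivAt_iter hI 2 ht))).add
      ((((dg'.const_mul 4).sub (hasArcDerivAt_const 1 t)).sub (dc.mul dc)).smul
        (h.hasArcDerivAt_iter hI 1 ht))).add
      ((dg''.sub (dc.mul dg)).smul (h.hasArcDerivAt_iter hI 0 ht)))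
  simp only [zero_add, one_add_one_eq_two, Nat.reduceAdd] at e
  have hS := S.third t ht
  have e3 := thirdNormal_eq υ Γ t
  rw [(h.hasArcDerivAt_strainEnergy hI ht).arcDeriv_eq (h.weight_pos t ht), strainGradient,
    strainEnergy]
  simp only [map_sub, map_smul, LinearMap.sub_apply, LinearMap.smul_apply, hS,
    scalarProduct_comm (torsionSec υ Γ t) (thirdNormal υ Γ t),
    scalarProduct_comm (normalDeriv υ Γ (torsionSec υ Γ) t) (torsionSec υ Γ t)] at e
  set c := scalarProduct n (arcDerivIter υ Γ 2 t) (arcDerivIter υ Γ 2 t)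
  set g := scalarProduct n (arcDerivIter υ Γ 2 t) (arcDerivIter υ Γ 3 t)
  rw [e3] at e
  rw [e]
  -- The value of δ is immaterial later, because Γ is paired with a field V satisfying ⟨Γ,V⟩ = 0.
  refine ⟨scalarProduct n (torsionSec υ Γ t) (torsionSec υ Γ t) + c + g * g +
    (arcDeriv υ (arcDeriv υ (arcDeriv υ
      (fun s => scalarProduct n (arcDerivIter υ Γ 2 s) (arcDerivIter υ Γ 3 s)))) t -
      (2 * g * g + c * arcDeriv υ
        (fun s => scalarProduct n (arcDerivIter υ Γ 2 s) (arcDerivIter υ Γ 3 s)) t)), ?_⟩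
  simp only [smul_eq_mul, mul_zero, sub_zero]
  module

/-- The first variation of the strain density, up to an exact derivative. -/
theorem hasArcDerivAt_boundaryTerm (h : IsArcLift I υ Γ) (hI : IsOpen I) {V : ℝ → Ambient n}
    (hV : ContDiffOn ℝ ∞ V I) {t : ℝ} (ht : t ∈ I)
    (h0 : scalarProduct n (Γ t) (V t) = 0)
    (h1 : scalarProduct n (arcDerivIter υ Γ 1 t) (arcDerivIter υ V 1 t) = 0) :
    HasArcDerivAt υ (boundaryTerm υ Γ V)
      (scalarProduct n (arcDerivIter υ Γ 3 t) (arcDerivIter υ V 3 t) +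
        2 * scalarProduct n (arcDerivIter υ Γ 2 t) (arcDerivIter υ Γ 2 t) *
          scalarProduct n (arcDerivIter υ Γ 2 t) (arcDerivIter υ V 2 t) +
        scalarProduct n (strainGradient υ Γ t) (V t)) t := by
  have dV := fun k => h.hasArcDerivAt hI
    (contDiffOn_arcDerivIter hI h.weight_smooth h.weight_pos hV k) ht
  have dX := h.hasArcDerivAt hI (h.contDiffOn_strainMomentum hI) ht
  have dX' := h.hasArcDerivAt hI (h.contDiffOn_arcDeriv hI (h.contDiffOn_strainMomentum hI)) ht
  have dE := h.hasArcDerivAt_strainEnergy hI ht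
  -- The explicit value of Ė is folded back into `arcDeriv`, so that it cancels against the
  -- coefficient of Γ̇ in the second derivative of the momentum.
  rw [← dE.arcDeriv_eq (h.weight_pos t ht)] at dE
  have key := ((((h.hasArcDerivAt_iter hI 3 ht).scalarProduct (dV 2)).sub
    (dX.scalarProduct (dV 1))).add (dX'.scalarProduct (dV 0))).sub
    (dE.mul ((h.hasArcDerivAt_iter hI 1 ht).scalarProduct (dV 0)))
  obtain ⟨δ, e⟩ := h.arcDeriv_arcDeriv_strainMomentum hI ht
  rw [e] at key
  change scalarProduct n (arcDerivIter υ Γ 0 t) (arcDerivIter υ V 0 t) = 0 at h0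
  convert (show HasArcDerivAt υ (boundaryTerm υ Γ V) _ t from key) using 1
  change _ + scalarProduct n (strainGradient υ Γ t) (arcDerivIter υ V 0 t) =
    scalarProduct n (arcDerivIter υ Γ 4 t) (arcDerivIter υ V 2 t) +
    scalarProduct n (arcDerivIter υ Γ 3 t) (arcDerivIter υ V 3 t) -
    (scalarProduct n (arcDeriv υ (strainMomentum υ Γ) t) (arcDerivIter υ V 1 t) +
      scalarProduct n (strainMomentum υ Γ t) (arcDerivIter υ V 2 t)) +
    (_ + scalarProduct n (arcDeriv υ (strainMomentum υ Γ) t) (arcDerivIter υ V 1 t)) -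
    (arcDeriv υ (strainEnergy υ Γ) t *
      scalarProduct n (arcDerivIter υ Γ 1 t) (arcDerivIter υ V 0 t) +
      strainEnergy υ Γ t * (scalarProduct n (arcDerivIter υ Γ 2 t) (arcDerivIter υ V 0 t) +
      scalarProduct n (arcDerivIter υ Γ 1 t) (arcDerivIter υ V 1 t)))
  -- The momentum is expanded only where it is paired with V̈: its Γ⁗ cancels and 2c⟨Γ̈,V̈⟩ is left.
  conv_rhs => enter [1, 1, 2, 2]; rw [strainMomentum]
  simp only [map_sub, map_add, map_smul, LinearMap.sub_apply, LinearMap.add_apply,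
    LinearMap.smul_apply, smul_eq_mul, h0, h1]
  ring

end IsArcLift

/-! ### The canonical lift as a unit lift with strain factor one -/

theorem IsUnitLift.congr {n : ℕ} {I : Set ℝ} (hI : IsOpen I) {υ : ℝ → ℝ} {Γ Γ' : ℝ → Ambient n}
    (h : IsUnitLift I υ Γ) (e : Set.EqOn Γ' Γ I) : IsUnitLift I υ Γ' where
  weight_smooth := h.weight_smooth
  weight_pos := h.weight_pos
  smooth := h.smooth.congr e
  null t ht := by rw [e ht, h.null t ht]
  unit t ht := by rw [arcDeriv_congr hI e ht, h.unit t ht]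

theorem strainFactor_congr {n : ℕ} {I : Set ℝ} (hI : IsOpen I) {υ : ℝ → ℝ} {Γ Γ' : ℝ → Ambient n}
    (e : Set.EqOn Γ Γ' I) : Set.EqOn (strainFactor υ Γ) (strainFactor υ Γ') I := fun t ht => by
  rw [strainFactor, strainFactor, arcDerivIter_congr hI e 2 ht, arcDerivIter_congr hI e 3 ht]

/-- The null-lift of a time-like curve that has unit speed with respect to the arc element
`υ dt`. -/
noncomputable def unitLift {n : ℕ} (υ : ℝ → ℝ) (γ : ℝ → Ambient n) (t : ℝ) : Ambient n :=
  (υ t / √(-scalarProduct n (deriv γ t) (deriv γ t))) • γ t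

/-- The terms containing r' drop out because ⟨γ,γ⟩ = ⟨γ,γ'⟩ = 0. Rescaling thus reaches any
prescribed speed without solving an equation for r. -/
theorem inner_deriv_smul {n : ℕ} {I : Set ℝ} (hI : IsOpen I) {γ : ℝ → Ambient n}
    (hγ : IsTimelikeCurve I γ) {r : ℝ → ℝ} (hr : ContDiffOn ℝ ∞ r I) {t : ℝ} (ht : t ∈ I) :
    scalarProduct n (deriv (fun s => r s • γ s) t) (deriv (fun s => r s • γ s) t) =
      r t ^ 2 * scalarProduct n (deriv γ t) (deriv γ t) := by
  obtain ⟨r1, r2, -, -⟩ := hγ.relations hI ht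
  rw [iteratedDeriv_one] at r2
  rw [((hasDerivAt_of_contDiffOn hI hr ht).fun_smul
    (hasDerivAt_of_contDiffOn hI hγ.smooth ht)).deriv]
  simp only [map_add, map_smul, LinearMap.add_apply, LinearMap.smul_apply, smul_eq_mul, r1, r2,
    scalarProduct_comm (deriv γ t) (γ t)]
  ring

theorem contDiffOn_unitLift_factor {n : ℕ} {I : Set ℝ} (hI : IsOpen I) {γ : ℝ → Ambient n}
    (hγ : IsTimelikeCurve I γ) {υ : ℝ → ℝ} (hυ : ContDiffOn ℝ ∞ υ I) :
    ContDiffOn ℝ ∞ (fun t => υ t / √(-scalarProduct n (deriv γ t) (deriv γ t))) I := by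
  have hd := ((contDiffOn_infty_iff_deriv_of_isOpen hI).1 hγ.smooth).2
  have hp (t : ℝ) (ht : t ∈ I) : 0 < -scalarProduct n (deriv γ t) (deriv γ t) :=
    neg_pos.2 (hγ.timelike t ht)
  exact hυ.div ((contDiffOn_scalarProduct hd hd).neg.sqrt fun t ht => (hp t ht).ne')
    fun t ht => (Real.sqrt_pos.2 (hp t ht)).ne'

theorem isUnitLift_unitLift {n : ℕ} {I : Set ℝ} (hI : IsOpen I) {γ : ℝ → Ambient n}
    (hγ : IsTimelikeCurve I γ) {υ : ℝ → ℝ} (hυ : ContDiffOn ℝ ∞ υ I) (h0 : ∀ t ∈ I, 0 < υ t) :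
    IsUnitLift I υ (unitLift υ γ) where
  weight_smooth := hυ
  weight_pos := h0
  smooth := (contDiffOn_unitLift_factor hI hγ hυ).smul hγ.smooth
  null t ht := by
    simp [unitLift, scalarProduct_self_of_mem (hγ.mem t ht)]
  unit t ht := by
    have hp : 0 < -scalarProduct n (deriv γ t) (deriv γ t) := neg_pos.2 (hγ.timelike t ht)
    have h := inner_deriv_smul hI hγ (contDiffOn_unitLift_factor hI hγ hυ) ht
    have hυ0 := (h0 t ht).ne'
    change scalarProduct n (deriv (unitLift υ γ) t) (deriv (unitLift υ γ) t) = _ at h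
    simp only [arcDeriv, map_smul, LinearMap.smul_apply, smul_eq_mul, h]
    rw [div_pow, Real.sq_sqrt hp.le]
    have hm := (hγ.timelike t ht).ne
    field_simp

/-- Invariance of the strain lets it be evaluated on the unit lift of an arbitrary positive weight,
unrelated to the curve. The variation argument applies this to neighbouring curves with the weight
of the initial one. -/
theorem strain_eq_strainFactor {n : ℕ} {I : Set ℝ} (hI : IsOpen I) {γ : ℝ → Ambient n}
    (hγ : IsTimelikeCurve I γ) {υ : ℝ → ℝ} (hυ : ContDiffOn ℝ ∞ υ I) (h0 : ∀ t ∈ I, 0 < υ t)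
    {t : ℝ} (ht : t ∈ I) : strain γ t = υ t ^ 4 * strainFactor υ (unitLift υ γ) t := by
  have h := isUnitLift_unitLift hI hγ hυ h0
  rw [← h.strain_eq hI ht]
  refine (strain_rescale hI hγ (contDiffOn_unitLift_factor hI hγ hυ) (fun s hs => ?_) h.smooth
    (fun _ _ => rfl) ht).1.symm
  exact div_pos (h0 s hs) (Real.sqrt_pos.2 (neg_pos.2 (hγ.timelike s hs)))

theorem strain_pos {n : ℕ} {I : Set ℝ} (hI : IsOpen I) {γ : ℝ → Ambient n}
    (hγ : IsTimelikeCurve I γ) (hgen : IsGeneric I γ) : ∀ t ∈ I, 0 < strain γ t :=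
  fun t ht => lt_of_le_of_ne ((strain_smooth_pos hI hγ).2 t ht) (hgen t ht).symm

/-- Since ⟨γ'',γ⟩ = -⟨γ',γ'⟩ > 0, the fourth root of its square is √(-⟨γ',γ'⟩). So the canonical
lift is the unit lift of weight strain^{1/4}. -/
theorem canonicalLift_factor_eq {n : ℕ} {I : Set ℝ} (hI : IsOpen I) {γ : ℝ → Ambient n}
    (hγ : IsTimelikeCurve I γ) (hgen : IsGeneric I γ) {t : ℝ} (ht : t ∈ I) :
    (strain γ t / (scalarProduct n (iteratedDeriv 2 γ t) (γ t)) ^ 2) ^ (1 / 4 : ℝ) =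
      strain γ t ^ (1 / 4 : ℝ) / √(-scalarProduct n (deriv γ t) (deriv γ t)) := by
  obtain ⟨-, -, r3, r4⟩ := hγ.relations hI ht
  rw [iteratedDeriv_one] at r3 r4
  rw [scalarProduct_comm, r3, Real.div_rpow (strain_pos hI hγ hgen t ht).le (sq_nonneg _),
    ← Real.rpow_natCast, ← Real.rpow_mul (by linarith), Real.sqrt_eq_rpow]
  norm_num

/-- Unit speed of the canonical lift for the weight strain^{1/4} says that ⟨Γ',Γ'⟩ is minus the
square of that weight. -/
theorem strainDensity_eq {n : ℕ} {I : Set ℝ} (hI : IsOpen I) {γ : ℝ → Ambient n}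
    (hγ : IsTimelikeCurve I γ) (hgen : IsGeneric I γ) {t : ℝ} (ht : t ∈ I) :
    strainDensity γ t = strain γ t ^ (1 / 4 : ℝ) := by
  have hs : ContDiffOn ℝ ∞ (fun t => strain γ t ^ (1 / 4 : ℝ)) I :=
    (strain_smooth_pos hI hγ).1.rpow_const_of_ne fun t ht => (strain_pos hI hγ hgen t ht).ne'
  have e : Set.EqOn (canonicalLift γ) (unitLift (fun t => strain γ t ^ (1 / 4 : ℝ)) γ) I :=
    fun s hs => by rw [canonicalLift, canonicalLift_factor_eq hI hγ hgen hs, unitLift]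
  have hpos (s : ℝ) (hs : s ∈ I) := Real.rpow_pos_of_pos (strain_pos hI hγ hgen s hs) (1 / 4)
  have h := ((isUnitLift_unitLift hI hγ hs hpos).congr hI e).unit t ht
  have h0 := (hpos t ht).ne'
  simp only [arcDeriv, map_smul, LinearMap.smul_apply, smul_eq_mul] at h
  have h' : scalarProduct n (deriv (canonicalLift γ) t) (deriv (canonicalLift γ) t) =
      -((strain γ t ^ (1 / 4 : ℝ)) ^ 2) := by
    field_simp at h
    linarith
  rw [strainDensity, h', abs_neg, abs_of_nonneg (sq_nonneg _), Real.sqrt_sq (hpos t ht).le]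

theorem strainDensity_smooth_pos {n : ℕ} {I : Set ℝ} (hI : IsOpen I) {γ : ℝ → Ambient n}
    (hγ : IsTimelikeCurve I γ) (hgen : IsGeneric I γ) :
    ContDiffOn ℝ ∞ (strainDensity γ) I ∧ ∀ t ∈ I, 0 < strainDensity γ t := by
  constructor
  · exact ((strain_smooth_pos hI hγ).1.rpow_const_of_ne
      fun t ht => (strain_pos hI hγ hgen t ht).ne').congr
        fun t ht => strainDensity_eq hI hγ hgen ht
  · intro t ht
    rw [strainDensity_eq hI hγ hgen ht]
    exact Real.rpow_pos_of_pos (strain_pos hI hγ hgen t ht) _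

theorem canonicalLift_eqOn {n : ℕ} {I : Set ℝ} (hI : IsOpen I) {γ : ℝ → Ambient n}
    (hγ : IsTimelikeCurve I γ) (hgen : IsGeneric I γ) :
    Set.EqOn (canonicalLift γ) (unitLift (strainDensity γ) γ) I := fun t ht => by
  rw [canonicalLift, canonicalLift_factor_eq hI hγ hgen ht, unitLift, strainDensity_eq hI hγ hgen ht]

theorem isArcLift_canonicalLift {n : ℕ} {I : Set ℝ} (hI : IsOpen I) {γ : ℝ → Ambient n}
    (hγ : IsTimelikeCurve I γ) (hgen : IsGeneric I γ) :
    IsArcLift I (strainDensity γ) (canonicalLift γ) := by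
  obtain ⟨hs, hp⟩ := strainDensity_smooth_pos hI hγ hgen
  have e := canonicalLift_eqOn hI hγ hgen
  refine ⟨(isUnitLift_unitLift hI hγ hs hp).congr hI e, fun t ht => ?_⟩
  have h := strain_eq_strainFactor hI hγ hs hp ht
  have hq := strain_pos hI hγ hgen t ht
  have h4 : strainDensity γ t ^ 4 = strain γ t := by
    rw [strainDensity_eq hI hγ hgen ht, ← Real.rpow_natCast, ← Real.rpow_mul hq.le]
    norm_num
  rw [strainFactor_congr hI e ht]
  rw [h4] at h
  exact mul_left_cancel₀ hq.ne' (by linarith)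

/-! ### Identification of the frame, the curvatures and W_γ -/

section Frame

variable {n : ℕ} {I : Set ℝ} {γ : ℝ → Ambient n}

theorem M₁_eqOn (h : IsArcLift I (strainDensity γ) (canonicalLift γ)) :
    Set.EqOn (M₁ γ) (arcDerivIter (strainDensity γ) (canonicalLift γ) 1) I := fun t ht => by
  have h1 := h.unit t ht
  change (1 / √|scalarProduct n (arcDeriv (strainDensity γ) (canonicalLift γ) t)
    (arcDeriv (strainDensity γ) (canonicalLift γ) t)|) •
      arcDeriv (strainDensity γ) (canonicalLift γ) t =
    arcDeriv (strainDensity γ) (canonicalLift γ) t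
  rw [h1]
  simp

theorem M₂_eqOn (hI : IsOpen I) (h : IsArcLift I (strainDensity γ) (canonicalLift γ)) :
    Set.EqOn (M₂ γ) (thirdNormal (strainDensity γ) (canonicalLift γ)) I := fun t ht => by
  change (1 / √(scalarProduct n (normalProj 2 (canonicalLift γ) t
    (arcDerivIter (strainDensity γ) (canonicalLift γ) 3 t)) (normalProj 2 (canonicalLift γ) t
    (arcDerivIter (strainDensity γ) (canonicalLift γ) 3 t)))) • normalProj 2 (canonicalLift γ) t
    (arcDerivIter (strainDensity γ) (canonicalLift γ) 3 t) = _
  rw [h.normalProj_two hI ht, h.thirdNormal_unit hI ht]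
  simp

theorem h₁_eqOn (hI : IsOpen I) (h : IsArcLift I (strainDensity γ) (canonicalLift γ)) :
    Set.EqOn (h₁ γ) (fun t => (-1 / 2) *
      scalarProduct n (arcDerivIter (strainDensity γ) (canonicalLift γ) 2 t)
        (arcDerivIter (strainDensity γ) (canonicalLift γ) 2 t)) I := fun t ht => by
  have e : dot γ (M₁ γ) t = arcDerivIter (strainDensity γ) (canonicalLift γ) 2 t :=
    arcDeriv_congr hI (M₁_eqOn h) ht
  have a := h.inner_zero_two hI ht
  have b := h.inner_one_two hI ht
  rw [h₁, e]
  set c := scalarProduct n (arcDerivIter (strainDensity γ) (canonicalLift γ) 2 t)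
    (arcDerivIter (strainDensity γ) (canonicalLift γ) 2 t) with hc
  set G := arcDerivIter (strainDensity γ) (canonicalLift γ)
  have e : Mlast γ t = (-(1 / scalarProduct n (G 0 t) (G 2 t))) • G 2 t +
    (scalarProduct n (G 1 t) (G 2 t) / scalarProduct n (G 0 t) (G 2 t)) • G 1 t +
    (1 / 2 * (scalarProduct n (G 2 t) (G 2 t) / scalarProduct n (G 0 t) (G 2 t) ^ 2 -
      scalarProduct n (G 1 t) (G 2 t) ^ 2 / scalarProduct n (G 0 t) (G 2 t) ^ 2)) • G 0 t := rfl
  -- With ⟨Γ,Γ̈⟩ = 1 and ⟨Γ̇,Γ̈⟩ = 0, the last frame vector is -Γ̈ + ½cΓ, and its product with Γ̈ is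
  -- -½c.
  rw [e, ← hc, a, b]
  simp only [map_add, map_smul, smul_eq_mul, scalarProduct_comm (G 2 t) (G 0 t), a, ← hc]
  ring

theorem Ssec_eqOn (hI : IsOpen I) (h : IsArcLift I (strainDensity γ) (canonicalLift γ)) :
    Set.EqOn (Ssec γ) (torsionSec (strainDensity γ) (canonicalLift γ)) I := fun t ht => by
  have S := h.isNormalSection_torsionSec hI
  have hF : strainFactor (strainDensity γ) (canonicalLift γ) t ≠ 0 := by simp [h.factor t ht]
  rw [Ssec, dot_eq_arcDeriv, arcDeriv_congr hI (M₂_eqOn hI h) ht, IsArcLift.arcDeriv_thirdNormal]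
  refine h.normalProj_three hI ht hF (S.zero t ht) (S.one t ht) (S.two t ht) (S.third t ht)
    0 (-1) ?_
  change _ - canonicalLift γ t = _
  module

theorem covDeriv_eqOn (hI : IsOpen I) (h : IsArcLift I (strainDensity γ) (canonicalLift γ))
    {V P : ℝ → Ambient n} (hP : IsNormalSection I (strainDensity γ) (canonicalLift γ) P)
    (hV : Set.EqOn V P I) :
    Set.EqOn (covDeriv γ V) (normalDeriv (strainDensity γ) (canonicalLift γ) P) I := fun t ht => by
  have S := h.isNormalSection_normalDeriv hI hP
  have hF : strainFactor (strainDensity γ) (canonicalLift γ) t ≠ 0 := by simp [h.factor t ht]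
  rw [covDeriv, dot_eq_arcDeriv, arcDeriv_congr hI hV ht]
  refine h.normalProj_three hI ht hF (S.zero t ht) (S.one t ht) (S.two t ht) (S.third t ht)
    (-scalarProduct n (torsionSec (strainDensity γ) (canonicalLift γ) t) (P t)) 0 ?_
  rw [normalDeriv]
  module

theorem torsionSec_nonneg (hI : IsOpen I) {υ : ℝ → ℝ} {Γ : ℝ → Ambient n} (h : IsArcLift I υ Γ)
    {t : ℝ} (ht : t ∈ I) : 0 ≤ scalarProduct n (torsionSec υ Γ t) (torsionSec υ Γ t) := by
  have S := h.isNormalSection_torsionSec hI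
  have h1 : scalarProduct n (arcDerivIter υ Γ 1 t) (arcDerivIter υ Γ 1 t) = -1 := h.unit t ht
  refine nonneg_of_orthogonal (h.null t ht) (h.inner_zero_one hI ht)
    ((h.inner_zero_two hI ht).trans (by rw [h1, neg_neg])) (by rw [h1]; norm_num) ?_
  exact mem_orthogonal_span_triple.2 ⟨S.zero t ht, S.one t ht, S.two t ht⟩

/-- Away from zeros this is half the derivative of ⟨S,S⟩, in which the N-component of Ṡ is invisible
because ⟨N,S⟩ = 0. -/
theorem h₂_mul_dot_h₂ (hI : IsOpen I) (h : IsArcLift I (strainDensity γ) (canonicalLift γ))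
    {t : ℝ} (ht : t ∈ I) : h₂ γ t * dot γ (h₂ γ) t =
      scalarProduct n (torsionSec (strainDensity γ) (canonicalLift γ) t)
        (normalDeriv (strainDensity γ) (canonicalLift γ)
          (torsionSec (strainDensity γ) (canonicalLift γ)) t) := by
  have S := h.isNormalSection_torsionSec hI
  have e : Set.EqOn (h₂ γ) (fun s =>
      √(scalarProduct n (torsionSec (strainDensity γ) (canonicalLift γ) s)
        (torsionSec (strainDensity γ) (canonicalLift γ) s))) I := fun s hs => by
    simp only [h₂, Ssec_eqOn hI h hs]
  rw [dot_eq_arcDeriv, arcDeriv_congr hI e ht, e ht]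
  beta_reduce
  have d := h.hasArcDerivAt_normalSection hI S.smooth ht
  have d2 := d.scalarProduct d
  have hNS := S.third t ht
  have h0 := h.weight_pos t ht
  have hnn (s : ℝ) (hs : s ∈ I) := torsionSec_nonneg hI h hs
  simp only [map_sub, map_smul, LinearMap.sub_apply, LinearMap.smul_apply, hNS,
    scalarProduct_comm (torsionSec (strainDensity γ) (canonicalLift γ) t)
      (thirdNormal (strainDensity γ) (canonicalLift γ) t),
    scalarProduct_comm (normalDeriv (strainDensity γ) (canonicalLift γ)
      (torsionSec (strainDensity γ) (canonicalLift γ)) t), smul_zero, sub_zero, ← two_mul] at d2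
  generalize torsionSec (strainDensity γ) (canonicalLift γ) = P at *
  rcases (hnn t ht).eq_or_lt' with h1 | h1
  -- The factor h₂ is zero, so whatever value `deriv` gives to the square root does not matter. The
  -- other side vanishes because ⟨S,S⟩ ≥ 0 has a minimum here.
  · rw [h1, Real.sqrt_zero, zero_mul]
    have hmin : IsLocalMin (fun s => scalarProduct n (P s) (P s)) t := by
      filter_upwards [hI.mem_nhds ht] with s hs
      rw [h1]
      exact hnn s hs
    have := hmin.hasDerivAt_eq_zero d2
    rw [smul_eq_mul] at this
    have := (mul_eq_zero.1 this).resolve_left h0.ne'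
    linarith
  · have hs := Real.sqrt_pos.2 h1
    rw [arcDeriv_of_hasDerivAt (HasDerivAt.sqrt d2 h1.ne'), smul_eq_mul, smul_eq_mul]
    field_simp

theorem Wsec_eqOn (hI : IsOpen I) (h : IsArcLift I (strainDensity γ) (canonicalLift γ)) :
    Set.EqOn (Wsec γ) (strainGradient (strainDensity γ) (canonicalLift γ)) I := fun t ht => by
  have S := h.isNormalSection_torsionSec hI
  have e1 : dot γ (h₁ γ) t =
      -scalarProduct n (arcDerivIter (strainDensity γ) (canonicalLift γ) 2 t)
        (arcDerivIter (strainDensity γ) (canonicalLift γ) 3 t) := by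
    rw [dot_eq_arcDeriv, arcDeriv_congr hI (h₁_eqOn hI h) ht,
      ((h.hasArcDerivAt_inner_two_two hI ht).const_mul (-1 / 2)).arcDeriv_eq (h.weight_pos t ht)]
    ring
  have e2 : h₂ γ t ^ 2 = scalarProduct n (torsionSec (strainDensity γ) (canonicalLift γ) t)
      (torsionSec (strainDensity γ) (canonicalLift γ) t) := by
    rw [h₂, Ssec_eqOn hI h ht, Real.sq_sqrt (torsionSec_nonneg hI h ht)]
  rw [Wsec, e1, mul_assoc, h₂_mul_dot_h₂ hI h ht, e2, h₁_eqOn hI h ht, M₂_eqOn hI h ht,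
    Ssec_eqOn hI h ht, covDeriv_eqOn hI h (h.isNormalSection_normalDeriv hI S)
      (covDeriv_eqOn hI h S (Ssec_eqOn hI h)) ht, strainGradient]
  module

end Frame

/-! ### Partial derivatives of two-parameter maps and differentiation under the integral -/

section Partial

variable {F : Type*} [NormedAddCommGroup F] [NormedSpace ℝ F]

/-- The partial derivative in the first variable. -/
noncomputable def partialFst (f : ℝ × ℝ → F) (p : ℝ × ℝ) : F :=
  deriv (fun s => f (s, p.2)) p.1

/-- The partial derivative in the second variable. -/
noncomputable def partialSnd (f : ℝ × ℝ → F) (p : ℝ × ℝ) : F :=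
  deriv (fun σ => f (p.1, σ)) p.2

/-- The iterated partial derivatives in the first variable with respect to the arc element
`υ dt`. -/
noncomputable def arcPartialIter (υ : ℝ → ℝ) (f : ℝ × ℝ → F) : ℕ → ℝ × ℝ → F
  | 0 => f
  | k + 1 => fun p => (υ p.1)⁻¹ • partialFst (arcPartialIter υ f k) p

theorem arcPartialIter_apply (υ : ℝ → ℝ) (f : ℝ × ℝ → F) (k : ℕ) (t τ : ℝ) :
    arcPartialIter υ f k (t, τ) = arcDerivIter υ (fun s => f (s, τ)) k t := by
  induction k generalizing t with
  | zero => rfl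
  | succ k ih =>
    change (υ t)⁻¹ • deriv (fun s => arcPartialIter υ f k (s, τ)) t = _
    simp only [ih]
    rfl

theorem hasDerivAt_fst {f : ℝ × ℝ → F} {U : Set (ℝ × ℝ)} (hU : IsOpen U)
    (hf : ContDiffOn ℝ ∞ f U) {p : ℝ × ℝ} (hp : p ∈ U) :
    HasDerivAt (fun s => f (s, p.2)) (fderiv ℝ f p (1, 0)) p.1 := by
  have h := ((hf.differentiableOn (by simp)).differentiableAt (hU.mem_nhds hp)).hasFDerivAt
  exact HasFDerivAt.comp_hasDerivAt (f := fun s : ℝ => (s, p.2)) p.1 h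
    ((hasDerivAt_id p.1).prodMk (hasDerivAt_const p.1 p.2))

theorem hasDerivAt_snd {f : ℝ × ℝ → F} {U : Set (ℝ × ℝ)} (hU : IsOpen U)
    (hf : ContDiffOn ℝ ∞ f U) {p : ℝ × ℝ} (hp : p ∈ U) :
    HasDerivAt (fun σ => f (p.1, σ)) (fderiv ℝ f p (0, 1)) p.2 := by
  have h := ((hf.differentiableOn (by simp)).differentiableAt (hU.mem_nhds hp)).hasFDerivAt
  exact HasFDerivAt.comp_hasDerivAt (f := fun σ : ℝ => (p.1, σ)) p.2 h
    ((hasDerivAt_const p.2 p.1).prodMk (hasDerivAt_id p.2))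

theorem hasDerivAt_partialSnd {f : ℝ × ℝ → F} {U : Set (ℝ × ℝ)} (hU : IsOpen U)
    (hf : ContDiffOn ℝ ∞ f U) {p : ℝ × ℝ} (hp : p ∈ U) :
    HasDerivAt (fun σ => f (p.1, σ)) (partialSnd f p) p.2 :=
  (hasDerivAt_snd hU hf hp).differentiableAt.hasDerivAt

theorem contDiffOn_fderiv_apply {f : ℝ × ℝ → F} {U : Set (ℝ × ℝ)} (hU : IsOpen U)
    (hf : ContDiffOn ℝ ∞ f U) (v : ℝ × ℝ) : ContDiffOn ℝ ∞ (fun p => fderiv ℝ f p v) U :=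
  ((contDiffOn_infty_iff_fderiv_of_isOpen hU).1 hf).2.clm_apply contDiffOn_const

theorem contDiffOn_partialFst {f : ℝ × ℝ → F} {U : Set (ℝ × ℝ)} (hU : IsOpen U)
    (hf : ContDiffOn ℝ ∞ f U) : ContDiffOn ℝ ∞ (partialFst f) U :=
  (contDiffOn_fderiv_apply hU hf (1, 0)).congr fun _ hp => (hasDerivAt_fst hU hf hp).deriv

theorem contDiffOn_partialSnd {f : ℝ × ℝ → F} {U : Set (ℝ × ℝ)} (hU : IsOpen U)
    (hf : ContDiffOn ℝ ∞ f U) : ContDiffOn ℝ ∞ (partialSnd f) U :=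
  (contDiffOn_fderiv_apply hU hf (0, 1)).congr fun _ hp => (hasDerivAt_snd hU hf hp).deriv

theorem isOpen_slice {U : Set (ℝ × ℝ)} (hU : IsOpen U) (τ : ℝ) : IsOpen {s | (s, τ) ∈ U} :=
  hU.preimage (by fun_prop)

theorem contDiffOn_slice {f : ℝ × ℝ → F} {U : Set (ℝ × ℝ)} (hf : ContDiffOn ℝ ∞ f U) (τ : ℝ) :
    ContDiffOn ℝ ∞ (fun s => f (s, τ)) {s | (s, τ) ∈ U} :=
  hf.comp (f := fun s : ℝ => (s, τ)) (contDiff_id.prodMk contDiff_const).contDiffOn fun _ hs => hs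

theorem partialFst_congr {f g : ℝ × ℝ → F} {U : Set (ℝ × ℝ)} (hU : IsOpen U)
    (h : Set.EqOn f g U) : Set.EqOn (partialFst f) (partialFst g) U := fun p hp => by
  have : (fun s => f (s, p.2)) =ᶠ[nhds p.1] fun s => g (s, p.2) := by
    filter_upwards [(isOpen_slice hU p.2).mem_nhds hp] with s hs using h hs
  exact this.deriv_eq

theorem partialSnd_partialFst {f : ℝ × ℝ → F} {U : Set (ℝ × ℝ)} (hU : IsOpen U)
    (hf : ContDiffOn ℝ ∞ f U) {p : ℝ × ℝ} (hp : p ∈ U) :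
    partialSnd (partialFst f) p = partialFst (partialSnd f) p := by
  have hd := ((contDiffOn_infty_iff_fderiv_of_isOpen hU).1 hf).2
  have hdd := (hd.differentiableOn (by simp)).differentiableAt (hU.mem_nhds hp)
  have hsymm := (hf.contDiffAt (hU.mem_nhds hp)).isSymmSndFDerivAt (by
    simp only [minSmoothness_of_isRCLikeNormedField]
    exact ENat.LEInfty.out)
  have e1 (v : ℝ × ℝ) : fderiv ℝ (fun q => fderiv ℝ f q v) p =
      (fderiv ℝ (fderiv ℝ f) p).flip v := by
    rw [fderiv_clm_apply hdd (differentiableAt_const v)]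
    simp
  have hfst := contDiffOn_partialFst hU hf
  have hsnd := contDiffOn_partialSnd hU hf
  have ef : partialFst f =ᶠ[nhds p] fun q => fderiv ℝ f q (1, 0) := by
    filter_upwards [hU.mem_nhds hp] with q hq using (hasDerivAt_fst hU hf hq).deriv
  have es : partialSnd f =ᶠ[nhds p] fun q => fderiv ℝ f q (0, 1) := by
    filter_upwards [hU.mem_nhds hp] with q hq using (hasDerivAt_snd hU hf hq).deriv
  rw [partialSnd, (hasDerivAt_snd hU hfst hp).deriv, partialFst,
    (hasDerivAt_fst hU hsnd hp).deriv, ef.fderiv_eq, es.fderiv_eq, e1, e1]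
  exact hsymm (0, 1) (1, 0)

theorem contDiffOn_arcPartialIter {υ : ℝ → ℝ} {I : Set ℝ} (hυ : ContDiffOn ℝ ∞ υ I)
    (h0 : ∀ t ∈ I, 0 < υ t) {f : ℝ × ℝ → F} {U : Set (ℝ × ℝ)} (hU : IsOpen U)
    (hUI : ∀ p ∈ U, p.1 ∈ I) (hf : ContDiffOn ℝ ∞ f U) (k : ℕ) :
    ContDiffOn ℝ ∞ (arcPartialIter υ f k) U := by
  induction k with
  | zero => exact hf
  | succ k ih =>
    exact ((hυ.comp contDiff_fst.contDiffOn hUI).inv fun p hp => (h0 _ (hUI p hp)).ne').smul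
      (contDiffOn_partialFst hU ih)

/-- Besides the symmetry of second derivatives, this rests on υ depending on t alone. It is the
reason for keeping the weight fixed along a variation. -/
theorem partialSnd_arcPartialIter {υ : ℝ → ℝ} {I : Set ℝ} (hυ : ContDiffOn ℝ ∞ υ I)
    (h0 : ∀ t ∈ I, 0 < υ t) {f : ℝ × ℝ → F} {U : Set (ℝ × ℝ)} (hU : IsOpen U)
    (hUI : ∀ p ∈ U, p.1 ∈ I) (hf : ContDiffOn ℝ ∞ f U) (k : ℕ) :
    Set.EqOn (partialSnd (arcPartialIter υ f k)) (arcPartialIter υ (partialSnd f) k) U := by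
  induction k with
  | zero => exact fun _ _ => rfl
  | succ k ih =>
    intro p hp
    have hk := contDiffOn_arcPartialIter hυ h0 hU hUI hf k
    have h := (hasDerivAt_partialSnd hU (contDiffOn_partialFst hU hk) hp).const_smul (υ p.1)⁻¹
    refine h.deriv.trans ?_
    rw [partialSnd_partialFst hU hk hp, partialFst_congr hU ih hp]
    rfl

theorem contDiffOn_scalarProduct_prod {n : ℕ} {f g : ℝ × ℝ → Ambient n} {U : Set (ℝ × ℝ)}
    (hf : ContDiffOn ℝ ∞ f U) (hg : ContDiffOn ℝ ∞ g U) :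
    ContDiffOn ℝ ∞ (fun p => scalarProduct n (f p) (g p)) U := by
  have hf := contDiffOn_pi.1 hf
  have hg := contDiffOn_pi.1 hg
  exact (((hf 0).mul (hg 0)).neg.sub ((hf 1).mul (hg 1))).add
    (ContDiffOn.sum fun (i : Fin n) _ => (hf i.succ.succ).mul (hg i.succ.succ))

end Partial

/-- A compact interval has a uniform neighbourhood in the parameter direction. -/
theorem exists_tube {U : Set (ℝ × ℝ)} (hU : IsOpen U) {a b : ℝ}
    (h : ∀ t ∈ Set.Icc a b, (t, 0) ∈ U) :
    ∃ δ > 0, ∀ t ∈ Set.Icc a b, ∀ τ ∈ Metric.closedBall (0 : ℝ) δ, (t, τ) ∈ U := by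
  obtain ⟨u, v, -, hv, hu, h0, huv⟩ := generalized_tube_lemma (isCompact_Icc (a := a) (b := b))
    (isCompact_singleton (x := (0 : ℝ))) hU (by
      rintro ⟨t, τ⟩ ⟨ht, rfl⟩
      exact h t ht)
  obtain ⟨δ, hδ, hball⟩ := Metric.nhds_basis_closedBall.mem_iff.1
    (hv.mem_nhds (Set.singleton_subset_iff.1 h0))
  exact ⟨δ, hδ, fun t ht τ hτ => huv ⟨hu ht, hball hτ⟩⟩

open MeasureTheory in
-- Compactness gives one δ for all of [a, b], and a bound of the τ-derivative on the compact product
-- serves as a constant dominating function.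
theorem hasDerivAt_integral_of_contDiffOn {f : ℝ × ℝ → ℝ} {U : Set (ℝ × ℝ)} (hU : IsOpen U)
    (hf : ContDiffOn ℝ ∞ f U) {a b : ℝ} (h : ∀ t ∈ Set.Icc a b, (t, 0) ∈ U) :
    HasDerivAt (fun τ => ∫ t in Set.Icc a b, f (t, τ)) (∫ t in Set.Icc a b, partialSnd f (t, 0))
      0 := by
  obtain ⟨δ, hδ, htube⟩ := exists_tube hU h
  have hf' := contDiffOn_partialSnd hU hf
  have hcomp : IsCompact (Set.Icc a b ×ˢ Metric.closedBall (0 : ℝ) δ) :=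
    isCompact_Icc.prod (isCompact_closedBall _ _)
  obtain ⟨C, hC⟩ := hcomp.exists_bound_of_continuousOn
    (hf'.continuousOn.mono fun p hp => htube p.1 hp.1 p.2 hp.2)
  have hc {φ : ℝ × ℝ → ℝ} (hφ : ContDiffOn ℝ ∞ φ U) {τ : ℝ} (hτ : τ ∈ Metric.closedBall 0 δ) :
      ContinuousOn (fun t => φ (t, τ)) (Set.Icc a b) :=
    (contDiffOn_slice hφ τ).continuousOn.mono fun t ht => htube t ht τ hτ
  have h0 : (0 : ℝ) ∈ Metric.closedBall 0 δ := Metric.mem_closedBall_self hδ.le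
  refine (hasDerivAt_integral_of_dominated_loc_of_deriv_le (bound := fun _ => C)
    (F' := fun τ t => partialSnd f (t, τ)) (Metric.closedBall_mem_nhds 0 hδ) ?_ ?_ ?_ ?_ ?_ ?_).2
  · filter_upwards [Metric.closedBall_mem_nhds 0 hδ] with τ hτ
    exact (hc hf hτ).aestronglyMeasurable measurableSet_Icc
  · exact (hc hf h0).integrableOn_Icc
  · exact (hc hf' h0).aestronglyMeasurable measurableSet_Icc
  · exact (ae_restrict_iff' measurableSet_Icc).2 (Filter.Eventually.of_forall
      fun t ht τ hτ => hC (t, τ) ⟨ht, hτ⟩)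
  · exact continuousOn_const.integrableOn_Icc
  · exact (ae_restrict_iff' measurableSet_Icc).2 (Filter.Eventually.of_forall
      fun t ht τ hτ => hasDerivAt_partialSnd hU hf (htube t ht τ hτ))

theorem arcDerivIter_eq_zero {n : ℕ} {υ : ℝ → ℝ} {V : ℝ → Ambient n} {O : Set ℝ} (hO : IsOpen O)
    (h : ∀ t ∈ O, V t = 0) (k : ℕ) : ∀ t ∈ O, arcDerivIter υ V k t = 0 := by
  induction k with
  | zero => exact h
  | succ k ih => exact fun t ht => arcDeriv_eq_zero_of_eqOn_const hO ih ht

/-- A smooth function that vanishes on `I` outside of `[a, b]` has vanishing derivatives at the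
ends of the interval. -/
theorem arcDerivIter_eq_zero_of_support {n : ℕ} {I : Set ℝ} (hI : IsOpen I) {υ : ℝ → ℝ}
    (hυ : ContDiffOn ℝ ∞ υ I) (h0 : ∀ t ∈ I, 0 < υ t) {V : ℝ → Ambient n}
    (hV : ContDiffOn ℝ ∞ V I) {a b : ℝ} (h : ∀ t ∈ I \ Set.Icc a b, V t = 0)
    {t : ℝ} (ht : t ∈ I) (hab : t = a ∨ t = b) (k : ℕ) : arcDerivIter υ V k t = 0 := by
  have hc : ContinuousAt (arcDerivIter υ V k) t :=
    (contDiffOn_arcDerivIter hI hυ h0 hV k).continuousOn.continuousAt (hI.mem_nhds ht)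
  have hz := arcDerivIter_eq_zero (υ := υ) (hI.sdiff isClosed_Icc) h k
  rcases hab with rfl | rfl
  -- The derivative is continuous at the endpoint and zero at nearby points outside [a, b]; these
  -- lie in I because I is open.
  · refine tendsto_nhds_unique (hc.mono_left (nhdsWithin_le_nhds (s := Set.Iio t)))
      (tendsto_const_nhds.congr' ?_)
    filter_upwards [self_mem_nhdsWithin, nhdsWithin_le_nhds (hI.mem_nhds ht)] with s hs hsI
    exact (hz s ⟨hsI, fun hs' => absurd hs'.1 (not_le.2 hs)⟩).symm
  · refine tendsto_nhds_unique (hc.mono_left (nhdsWithin_le_nhds (s := Set.Ioi t)))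
      (tendsto_const_nhds.congr' ?_)
    filter_upwards [self_mem_nhdsWithin, nhdsWithin_le_nhds (hI.mem_nhds ht)] with s hs hsI
    exact (hz s ⟨hsI, fun hs' => absurd hs'.2 (not_le.2 hs)⟩).symm

/-! ### First variation of the total strain -/

section Variation

variable {n : ℕ} {I : Set ℝ} {γ : ℝ → Ambient n} {ε : ℝ} {g : ℝ → ℝ → Ambient n}

/-- The unit lifts of the curves of a variation, for the arc element of the initial curve. -/
noncomputable def variationLift (γ : ℝ → Ambient n) (g : ℝ → ℝ → Ambient n) (p : ℝ × ℝ) :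
    Ambient n :=
  unitLift (strainDensity γ) (fun t => g t p.2) p.1

/-- The parameters at which the curves of a variation are time-like. -/
def timelikeDomain (I : Set ℝ) (ε : ℝ) (g : ℝ → ℝ → Ambient n) : Set (ℝ × ℝ) :=
  {p | p ∈ I ×ˢ Set.Ioo (-ε) ε ∧
    scalarProduct n (deriv (fun t => g t p.2) p.1) (deriv (fun t => g t p.2) p.1) < 0}

/-- The strain factor of the curves of a variation. -/
noncomputable def variationFactor (γ : ℝ → Ambient n) (g : ℝ → ℝ → Ambient n) (p : ℝ × ℝ) : ℝ :=
  strainFactor (strainDensity γ) (unitLift (strainDensity γ) (fun t => g t p.2)) p.1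

/-- The parameters at which the curves of a variation are time-like and generic. -/
def genericDomain (I : Set ℝ) (ε : ℝ) (γ : ℝ → Ambient n) (g : ℝ → ℝ → Ambient n) :
    Set (ℝ × ℝ) :=
  {p | p ∈ timelikeDomain I ε g ∧ 0 < variationFactor γ g p}

theorem isOpen_timelikeDomain (hI : IsOpen I) (hg : IsVariation I γ ε g) :
    IsOpen (timelikeDomain I ε g) := by
  have hΩ := hI.prod (isOpen_Ioo (a := -ε) (b := ε))
  have hd := contDiffOn_partialFst hΩ hg.smooth
  exact (contDiffOn_scalarProduct_prod hd hd).continuousOn.isOpen_inter_preimage hΩ isOpen_Iio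

theorem mem_timelikeDomain_zero (hI : IsOpen I) (hγ : IsTimelikeCurve I γ)
    (hg : IsVariation I γ ε g) {t : ℝ} (ht : t ∈ I) : (t, (0 : ℝ)) ∈ timelikeDomain I ε g := by
  refine ⟨⟨ht, neg_lt_zero.2 hg.pos, hg.pos⟩, ?_⟩
  have e : deriv (fun t => g t 0) t = deriv γ t :=
    (Set.EqOn.eventuallyEq_of_mem hg.zero (hI.mem_nhds ht)).deriv_eq
  change scalarProduct n (deriv (fun t => g t 0) t) (deriv (fun t => g t 0) t) < 0
  rw [e]
  exact hγ.timelike t ht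

/-- A slice at fixed τ is in general not all of I. The local results on time-like curves apply to it
because their proofs use only that the parameter set is open. -/
theorem isTimelikeCurve_slice (hg : IsVariation I γ ε g) {U : Set (ℝ × ℝ)}
    (hU : U ⊆ timelikeDomain I ε g) (τ : ℝ) :
    IsTimelikeCurve {s | (s, τ) ∈ U} (fun s => g s τ) where
  smooth := contDiffOn_slice (hg.smooth.mono fun _ hp => (hU hp).1) τ
  mem _ hs := hg.mem _ (hU hs).1.1 _ (hU hs).1.2
  timelike _ hs := (hU hs).2

theorem contDiffOn_variationLift_factor (hI : IsOpen I) (hγ : IsTimelikeCurve I γ)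
    (hgen : IsGeneric I γ) (hg : IsVariation I γ ε g) :
    ContDiffOn ℝ ∞ (fun p : ℝ × ℝ => strainDensity γ p.1 /
      √(-scalarProduct n (deriv (fun t => g t p.2) p.1) (deriv (fun t => g t p.2) p.1)))
      (timelikeDomain I ε g) := by
  have hΩ := hI.prod (isOpen_Ioo (a := -ε) (b := ε))
  have hd := (contDiffOn_partialFst hΩ hg.smooth).mono
    (fun p (hp : p ∈ timelikeDomain I ε g) => hp.1)
  have hp (p : ℝ × ℝ) (hp : p ∈ timelikeDomain I ε g) :
    0 < -scalarProduct n (deriv (fun t => g t p.2) p.1) (deriv (fun t => g t p.2) p.1) :=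
    neg_pos.2 hp.2
  exact ((strainDensity_smooth_pos hI hγ hgen).1.comp contDiff_fst.contDiffOn
    fun p hp => hp.1.1).div ((contDiffOn_scalarProduct_prod hd hd).neg.sqrt
      fun p h => (hp p h).ne') fun p h => (Real.sqrt_pos.2 (hp p h)).ne'

theorem contDiffOn_variationLift (hI : IsOpen I) (hγ : IsTimelikeCurve I γ)
    (hgen : IsGeneric I γ) (hg : IsVariation I γ ε g) :
    ContDiffOn ℝ ∞ (variationLift γ g) (timelikeDomain I ε g) :=
  (contDiffOn_variationLift_factor hI hγ hgen hg).smul (hg.smooth.mono fun _ hp => hp.1)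

theorem variationFactor_eq (p : ℝ × ℝ) : variationFactor γ g p =
    scalarProduct n (arcPartialIter (strainDensity γ) (variationLift γ g) 3 p)
      (arcPartialIter (strainDensity γ) (variationLift γ g) 3 p) +
    scalarProduct n (arcPartialIter (strainDensity γ) (variationLift γ g) 2 p)
      (arcPartialIter (strainDensity γ) (variationLift γ g) 2 p) ^ 2 := by
  obtain ⟨t, τ⟩ := p
  simp only [arcPartialIter_apply]
  rfl

theorem contDiffOn_arcPartialIter_variationLift (hI : IsOpen I) (hγ : IsTimelikeCurve I γ)
    (hgen : IsGeneric I γ) (hg : IsVariation I γ ε g) (k : ℕ) :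
    ContDiffOn ℝ ∞ (arcPartialIter (strainDensity γ) (variationLift γ g) k)
      (timelikeDomain I ε g) := by
  obtain ⟨hs, hp⟩ := strainDensity_smooth_pos hI hγ hgen
  exact contDiffOn_arcPartialIter hs hp (isOpen_timelikeDomain hI hg) (fun p hp => hp.1.1)
    (contDiffOn_variationLift hI hγ hgen hg) k

theorem contDiffOn_variationFactor (hI : IsOpen I) (hγ : IsTimelikeCurve I γ)
    (hgen : IsGeneric I γ) (hg : IsVariation I γ ε g) :
    ContDiffOn ℝ ∞ (variationFactor γ g) (timelikeDomain I ε g) := by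
  have h := contDiffOn_arcPartialIter_variationLift hI hγ hgen hg
  exact ((contDiffOn_scalarProduct_prod (h 3) (h 3)).add
    ((contDiffOn_scalarProduct_prod (h 2) (h 2)).pow 2)).congr fun p _ => variationFactor_eq p

theorem isOpen_genericDomain (hI : IsOpen I) (hγ : IsTimelikeCurve I γ)
    (hgen : IsGeneric I γ) (hg : IsVariation I γ ε g) : IsOpen (genericDomain I ε γ g) :=
  (contDiffOn_variationFactor hI hγ hgen hg).continuousOn.isOpen_inter_preimage
    (isOpen_timelikeDomain hI hg) isOpen_Ioi

theorem variationLift_zero (hI : IsOpen I) (hγ : IsTimelikeCurve I γ)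
    (hgen : IsGeneric I γ) (hg : IsVariation I γ ε g) :
    Set.EqOn (fun t => variationLift γ g (t, 0)) (canonicalLift γ) I := fun t ht => by
  have e : deriv (fun t => g t 0) t = deriv γ t :=
    (Set.EqOn.eventuallyEq_of_mem hg.zero (hI.mem_nhds ht)).deriv_eq
  simp only [canonicalLift_eqOn hI hγ hgen ht, variationLift, unitLift, e, hg.zero t ht]

theorem variationFactor_zero (hI : IsOpen I) (hγ : IsTimelikeCurve I γ)
    (hgen : IsGeneric I γ) (hg : IsVariation I γ ε g) {t : ℝ} (ht : t ∈ I) :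
    variationFactor γ g (t, 0) = 1 :=
  (strainFactor_congr hI (variationLift_zero hI hγ hgen hg) ht).trans
    ((isArcLift_canonicalLift hI hγ hgen).factor t ht)

theorem mem_genericDomain_zero (hI : IsOpen I) (hγ : IsTimelikeCurve I γ)
    (hgen : IsGeneric I γ) (hg : IsVariation I γ ε g) {t : ℝ} (ht : t ∈ I) :
    (t, (0 : ℝ)) ∈ genericDomain I ε γ g :=
  ⟨mem_timelikeDomain_zero hI hγ hg ht, by simp [variationFactor_zero hI hγ hgen hg ht]⟩

/-- The strain densities of the curves of a variation. -/
theorem strainDensity_slice (hI : IsOpen I) (hγ : IsTimelikeCurve I γ)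
    (hgen : IsGeneric I γ) (hg : IsVariation I γ ε g) {t τ : ℝ}
    (ht : (t, τ) ∈ genericDomain I ε γ g) :
    strainDensity (fun s => g s τ) t =
      strainDensity γ t * variationFactor γ g (t, τ) ^ (1 / 4 : ℝ) := by
  obtain ⟨hs, hp⟩ := strainDensity_smooth_pos hI hγ hgen
  have hJ := isOpen_slice (isOpen_genericDomain hI hγ hgen hg) τ
  have hJI : {s | (s, τ) ∈ genericDomain I ε γ g} ⊆ I := fun s hs => hs.1.1.1
  have hc := isTimelikeCurve_slice hg (U := genericDomain I ε γ g) (fun _ h => h.1) τ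
  have e (s : ℝ) (h : (s, τ) ∈ genericDomain I ε γ g) : strain (fun s => g s τ) s =
      strainDensity γ s ^ 4 * variationFactor γ g (s, τ) :=
    strain_eq_strainFactor hJ hc (hs.mono hJI) (fun s h => hp s (hJI h)) h
  have hG : IsGeneric {s | (s, τ) ∈ genericDomain I ε γ g} (fun s => g s τ) := by
    intro s h
    rw [e s h]
    exact (mul_pos (pow_pos (hp s (hJI h)) 4) h.2).ne'
  have h0 := hp t (hJI ht)
  rw [strainDensity_eq hJ hc hG ht, e t ht, Real.mul_rpow (pow_pos h0 4).le ht.2.le,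
    ← Real.rpow_natCast, ← Real.rpow_mul h0.le]
  norm_num

/-- The infinitesimal variation of the canonical lift. -/
noncomputable def variationField (γ : ℝ → Ambient n) (g : ℝ → ℝ → Ambient n) (t : ℝ) : Ambient n :=
  partialSnd (variationLift γ g) (t, 0)

theorem contDiffOn_variationField (hI : IsOpen I) (hγ : IsTimelikeCurve I γ)
    (hgen : IsGeneric I γ) (hg : IsVariation I γ ε g) :
    ContDiffOn ℝ ∞ (variationField γ g) I :=
  (contDiffOn_slice (contDiffOn_partialSnd (isOpen_timelikeDomain hI hg)
    (contDiffOn_variationLift hI hγ hgen hg)) 0).mono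
      fun _ ht => mem_timelikeDomain_zero hI hγ hg ht

theorem isUnitLift_variationLift (hI : IsOpen I) (hγ : IsTimelikeCurve I γ)
    (hgen : IsGeneric I γ) (hg : IsVariation I γ ε g) (τ : ℝ) :
    IsUnitLift {s | (s, τ) ∈ timelikeDomain I ε g} (strainDensity γ)
      (fun s => variationLift γ g (s, τ)) := by
  obtain ⟨hs, hp⟩ := strainDensity_smooth_pos hI hγ hgen
  have hJI : {s | (s, τ) ∈ timelikeDomain I ε g} ⊆ I := fun s hs => hs.1.1
  exact isUnitLift_unitLift (isOpen_slice (isOpen_timelikeDomain hI hg) τ)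
    (isTimelikeCurve_slice hg subset_rfl τ) (hs.mono hJI) fun s h => hp s (hJI h)

theorem hasDerivAt_arcPartialIter_zero (hI : IsOpen I) (hγ : IsTimelikeCurve I γ)
    (hgen : IsGeneric I γ) (hg : IsVariation I γ ε g) {t : ℝ} (ht : t ∈ I) (k : ℕ) :
    HasDerivAt (fun τ => arcPartialIter (strainDensity γ) (variationLift γ g) k (t, τ))
      (arcDerivIter (strainDensity γ) (variationField γ g) k t) 0 := by
  obtain ⟨hs, hp⟩ := strainDensity_smooth_pos hI hγ hgen
  have hU := isOpen_timelikeDomain hI hg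
  have hm := mem_timelikeDomain_zero hI hγ hg ht
  have h := hasDerivAt_partialSnd hU (contDiffOn_arcPartialIter_variationLift hI hγ hgen hg k) hm
  rw [partialSnd_arcPartialIter hs hp hU (fun p hp => hp.1.1)
    (contDiffOn_variationLift hI hγ hgen hg) k hm, arcPartialIter_apply] at h
  exact h

theorem arcPartialIter_zero (hI : IsOpen I) (hγ : IsTimelikeCurve I γ)
    (hgen : IsGeneric I γ) (hg : IsVariation I γ ε g) {t : ℝ} (ht : t ∈ I) (k : ℕ) :
    arcPartialIter (strainDensity γ) (variationLift γ g) k (t, 0) =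
      arcDerivIter (strainDensity γ) (canonicalLift γ) k t := by
  rw [arcPartialIter_apply, arcDerivIter_congr hI (variationLift_zero hI hγ hgen hg) k ht]

theorem eventually_mem_timelikeDomain (hI : IsOpen I) (hγ : IsTimelikeCurve I γ)
    (hg : IsVariation I γ ε g) {t : ℝ} (ht : t ∈ I) :
    ∀ᶠ τ in nhds (0 : ℝ), (t, τ) ∈ timelikeDomain I ε g :=
  (Continuous.prodMk_right t).continuousAt.eventually
    ((isOpen_timelikeDomain hI hg).mem_nhds (mem_timelikeDomain_zero hI hγ hg ht))

/-- These linearize ⟨Γ_τ,Γ_τ⟩ = 0 and ⟨Γ̇_τ,Γ̇_τ⟩ = -1, which hold for all τ near 0 at a given t.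
They are the two constraints used in the integration by parts. -/
theorem inner_variationField (hI : IsOpen I) (hγ : IsTimelikeCurve I γ)
    (hgen : IsGeneric I γ) (hg : IsVariation I γ ε g) {t : ℝ} (ht : t ∈ I) :
    scalarProduct n (canonicalLift γ t) (variationField γ g t) = 0 ∧
    scalarProduct n (arcDerivIter (strainDensity γ) (canonicalLift γ) 1 t)
      (arcDerivIter (strainDensity γ) (variationField γ g) 1 t) = 0 := by
  have d := hasDerivAt_arcPartialIter_zero hI hγ hgen hg ht
  have key (k : ℕ) (x : ℝ) (h : ∀ᶠ τ in nhds (0 : ℝ), scalarProduct n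
      (arcPartialIter (strainDensity γ) (variationLift γ g) k (t, τ))
      (arcPartialIter (strainDensity γ) (variationLift γ g) k (t, τ)) = x) :
      scalarProduct n (arcDerivIter (strainDensity γ) (canonicalLift γ) k t)
        (arcDerivIter (strainDensity γ) (variationField γ g) k t) = 0 := by
    have := (hasDerivAt_scalarProduct (d k) (d k)).unique
      ((hasDerivAt_const (0 : ℝ) x).congr_of_eventuallyEq h)
    rw [arcPartialIter_zero hI hγ hgen hg ht,
      scalarProduct_comm (arcDerivIter (strainDensity γ) (variationField γ g) k t)] at this
    linarith
  constructor
  · refine key 0 0 ?_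
    filter_upwards [eventually_mem_timelikeDomain hI hγ hg ht] with τ hτ
    exact (isUnitLift_variationLift hI hγ hgen hg τ).null t hτ
  · refine key 1 (-1) ?_
    filter_upwards [eventually_mem_timelikeDomain hI hγ hg ht] with τ hτ
    exact (isUnitLift_variationLift hI hγ hgen hg τ).unit t hτ

theorem partialSnd_variationFactor (hI : IsOpen I) (hγ : IsTimelikeCurve I γ)
    (hgen : IsGeneric I γ) (hg : IsVariation I γ ε g) {t : ℝ} (ht : t ∈ I) :
    HasDerivAt (fun τ => variationFactor γ g (t, τ))
      (2 * (scalarProduct n (arcDerivIter (strainDensity γ) (canonicalLift γ) 3 t)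
          (arcDerivIter (strainDensity γ) (variationField γ g) 3 t) +
        2 * scalarProduct n (arcDerivIter (strainDensity γ) (canonicalLift γ) 2 t)
          (arcDerivIter (strainDensity γ) (canonicalLift γ) 2 t) *
        scalarProduct n (arcDerivIter (strainDensity γ) (canonicalLift γ) 2 t)
          (arcDerivIter (strainDensity γ) (variationField γ g) 2 t))) 0 := by
  have d := hasDerivAt_arcPartialIter_zero hI hγ hgen hg ht
  simp only [variationFactor_eq]
  refine ((hasDerivAt_scalarProduct (d 3) (d 3)).fun_add
    ((hasDerivAt_scalarProduct (d 2) (d 2)).fun_pow 2)).congr_deriv ?_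
  simp only [arcPartialIter_zero hI hγ hgen hg ht,
    scalarProduct_comm (arcDerivIter (strainDensity γ) (variationField γ g) _ t)]
  push_cast
  ring

theorem variationField_eq_zero (hI : IsOpen I) (hg : IsVariation I γ ε g) {a b : ℝ}
    (hsupp : variationSupport I γ ε g ⊆ Set.Icc a b) :
    ∀ t ∈ I \ Set.Icc a b, variationField γ g t = 0 := by
  intro t ht
  have hO := hI.sdiff (isClosed_Icc (a := a) (b := b))
  have e (τ : ℝ) (hτ : τ ∈ Set.Ioo (-ε) ε) : Set.EqOn (fun s => g s τ) γ (I \ Set.Icc a b) := by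
    intro s hs
    by_contra hne
    exact hs.2 (hsupp (subset_closure ⟨hs.1, τ, hτ, hne⟩))
  have hc : (fun σ => variationLift γ g (t, σ)) =ᶠ[nhds 0]
      fun _ => unitLift (strainDensity γ) γ t := by
    -- The lift at t involves the t-derivative of γ_τ, so agreement with γ is needed in a
    -- neighbourhood of t and not just at t.
    filter_upwards [Ioo_mem_nhds (neg_lt_zero.2 hg.pos) hg.pos] with τ hτ
    have e1 : g t τ = γ t := e τ hτ ht
    simp only [variationLift, unitLift, ((e τ hτ).eventuallyEq_of_mem (hO.mem_nhds ht)).deriv_eq,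
      e1]
  exact hc.deriv_eq.trans (deriv_const _ _)

/-- The lift is a positive factor ρ times γ_τ. The derivative of ρ contributes a multiple of γ, to
which the gradient is orthogonal, so only the velocity of the variation in the Einstein universe
counts. -/
theorem inner_strainGradient_variationField (hI : IsOpen I) (hγ : IsTimelikeCurve I γ)
    (hgen : IsGeneric I γ) (hg : IsVariation I γ ε g) {t : ℝ} (ht : t ∈ I) :
    scalarProduct n (strainGradient (strainDensity γ) (canonicalLift γ) t) (variationField γ g t) =
      strainDensity γ t / √(-scalarProduct n (deriv γ t) (deriv γ t)) *
        scalarProduct n (strainGradient (strainDensity γ) (canonicalLift γ) t)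
          (deriv (fun τ => g t τ) 0) := by
  have h := isArcLift_canonicalLift hI hγ hgen
  have hm := mem_timelikeDomain_zero hI hγ hg ht
  have hr : 0 < strainDensity γ t / √(-scalarProduct n (deriv γ t) (deriv γ t)) :=
    div_pos (h.weight_pos t ht) (Real.sqrt_pos.2 (neg_pos.2 (hγ.timelike t ht)))
  have horth := (h.inner_strainGradient hI ht).1
  change scalarProduct n (canonicalLift γ t) _ = 0 at horth
  rw [canonicalLift_eqOn hI hγ hgen ht, unitLift, map_smul, LinearMap.smul_apply, smul_eq_mul,
    mul_eq_zero, or_iff_right hr.ne', scalarProduct_comm] at horth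
  have d1 := hasDerivAt_partialSnd (isOpen_timelikeDomain hI hg)
    (contDiffOn_variationLift_factor hI hγ hgen hg) hm
  have d2 := hasDerivAt_partialSnd (hI.prod isOpen_Ioo) hg.smooth hm.1
  have e : deriv (fun t => g t 0) t = deriv γ t :=
    (Set.EqOn.eventuallyEq_of_mem hg.zero (hI.mem_nhds ht)).deriv_eq
  have := (d1.fun_smul d2).deriv
  change variationField γ g t = _ at this
  rw [this]
  simp only [map_add, map_smul, smul_eq_mul, hg.zero t ht, horth, e, partialSnd, mul_zero,
    add_zero]

open MeasureTheory in
/-- The first variation of the total strain. -/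
theorem hasDerivAt_totalStrain (hI : IsOpen I) (hγ : IsTimelikeCurve I γ)
    (hgen : IsGeneric I γ) (hg : IsVariation I γ ε g) {a b : ℝ} (hab : a ≤ b)
    (hK : Set.Icc a b ⊆ I) (hsupp : variationSupport I γ ε g ⊆ Set.Icc a b) :
    HasDerivAt (fun τ => totalStrain a b (fun t => g t τ))
      (-(1 / 2) * ∫ t in a..b, strainDensity γ t *
        scalarProduct n (strainGradient (strainDensity γ) (canonicalLift γ) t)
          (variationField γ g t)) 0 := by
  have h := isArcLift_canonicalLift hI hγ hgen
  obtain ⟨hs, hp⟩ := strainDensity_smooth_pos hI hγ hgen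
  have hU := isOpen_genericDomain hI hγ hgen hg
  have hmem (t : ℝ) (ht : t ∈ Set.Icc a b) : (t, (0 : ℝ)) ∈ genericDomain I ε γ g :=
    mem_genericDomain_zero hI hγ hgen hg (hK ht)
  set f : ℝ × ℝ → ℝ := fun p => strainDensity γ p.1 * variationFactor γ g p ^ (1 / 4 : ℝ)
  have hf : ContDiffOn ℝ ∞ f (genericDomain I ε γ g) :=
    (hs.comp contDiff_fst.contDiffOn fun p hp => hp.1.1.1).mul
      (((contDiffOn_variationFactor hI hγ hgen hg).mono fun p hp => hp.1).rpow_const_of_ne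
        fun p hp => hp.2.ne')
  have hV := contDiffOn_variationField hI hγ hgen hg
  have hd := hasDerivAt_integral_of_contDiffOn hU hf hmem
  -- The strain density on the left is formed with the canonical lift of γ_τ itself. It has the
  -- product form once τ is so small that all of K consists of generic time-like points of γ_τ.
  have heq : (fun τ => totalStrain a b (fun t => g t τ)) =ᶠ[nhds 0]
      fun τ => ∫ t in Set.Icc a b, f (t, τ) := by
    obtain ⟨δ, hδ, htube⟩ := exists_tube hU hmem
    filter_upwards [Metric.closedBall_mem_nhds 0 hδ] with τ hτ
    exact setIntegral_congr_fun measurableSet_Icc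
      fun t ht => strainDensity_slice hI hγ hgen hg (htube t ht τ hτ)
  refine (hd.congr_of_eventuallyEq heq).congr_deriv ?_
  set w : ℝ → ℝ := fun t => strainDensity γ t *
    scalarProduct n (strainGradient (strainDensity γ) (canonicalLift γ) t) (variationField γ g t)
  have hw : ContinuousOn w (Set.Icc a b) := (hs.mul (contDiffOn_scalarProduct
    (h.contDiffOn_strainGradient hI) hV)).continuousOn.mono hK
  have hf' : ContinuousOn (fun t => partialSnd f (t, 0)) (Set.Icc a b) :=
    (contDiffOn_slice (contDiffOn_partialSnd hU hf) 0).continuousOn.mono hmem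
  have hf2 : ContinuousOn (fun t => 2 * partialSnd f (t, 0)) (Set.Icc a b) :=
    continuousOn_const.mul hf'
  -- At F = 1 the τ-derivative of υF^{1/4} is υ/4 times that of F, which is twice the bracket in Ḃ.
  -- Hence υ times the bracket is 2 ∂f/∂τ.
  have hB (t : ℝ) (ht : t ∈ Set.Icc a b) : HasDerivAt
      (boundaryTerm (strainDensity γ) (canonicalLift γ) (variationField γ g))
      (2 * partialSnd f (t, 0) + w t) t := by
    obtain ⟨i0, i1⟩ := inner_variationField hI hγ hgen hg (hK ht)
    refine HasDerivAt.congr_deriv (h.hasArcDerivAt_boundaryTerm hI hV (hK ht) i0 i1) ?_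
    have hF := variationFactor_zero hI hγ hgen hg (hK ht)
    have e : partialSnd f (t, 0) = _ := (((partialSnd_variationFactor hI hγ hgen hg
      (hK ht)).rpow_const (p := 1 / 4) (Or.inl (by rw [hF]; exact one_ne_zero))).const_mul
        (strainDensity γ t)).deriv
    rw [e, hF, Real.one_rpow, smul_eq_mul]
    ring
  have hzero (t : ℝ) (ht : t ∈ I) (hab : t = a ∨ t = b) :
      boundaryTerm (strainDensity γ) (canonicalLift γ) (variationField γ g) t = 0 := by
    have z := arcDerivIter_eq_zero_of_support hI hs hp hV
      (variationField_eq_zero hI hg hsupp) ht hab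
    simp [boundaryTerm, z]
  have hint := intervalIntegral.integral_eq_sub_of_hasDerivAt
    (fun t ht => hB t (by rwa [Set.uIcc_of_le hab] at ht))
    (ContinuousOn.intervalIntegrable_of_Icc hab (hf2.add hw))
  rw [hzero b (hK (Set.right_mem_Icc.2 hab)) (Or.inr rfl),
    hzero a (hK (Set.left_mem_Icc.2 hab)) (Or.inl rfl), sub_zero,
    intervalIntegral.integral_add (hf2.intervalIntegrable_of_Icc hab)
      (hw.intervalIntegrable_of_Icc hab), intervalIntegral.integral_const_mul] at hint
  rw [integral_Icc_eq_integral_Ioc, ← intervalIntegral.integral_of_le hab]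
  linarith

end Variation

/-! ### Definiteness of the normal space and test variations -/

/-- The scalar product is non-degenerate. -/
theorem eq_zero_of_forall_scalarProduct {n : ℕ} {V : Ambient n}
    (h : ∀ U, scalarProduct n U V = 0) : V = 0 := by
  ext i
  refine Fin.cases ?_ (fun j => Fin.cases ?_ (fun k => ?_) j) i
  · simpa [scalarProduct_apply] using h (Pi.single 0 1)
  · simpa [scalarProduct_apply, Pi.single_apply, Fin.ext_iff] using h (Pi.single 1 1)
  · simpa [scalarProduct_apply, Pi.single_apply, Fin.ext_iff (a := (0 : Fin (n + 2))),
      Fin.ext_iff (a := (1 : Fin (n + 2)))] using h (Pi.single k.succ.succ 1)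

/-- The second normal space of a time-like curve is positive definite. -/
theorem eq_zero_of_orthogonal {n : ℕ} {a b c V : Ambient n} (haa : scalarProduct n a a = 0)
    (hab : scalarProduct n a b = 0)
    (hac : scalarProduct n a c = -scalarProduct n b b) (hbb : scalarProduct n b b < 0)
    (hV : V ∈ (scalarProduct n).orthogonal (Submodule.span ℝ {a, b, c}))
    (h0 : scalarProduct n V V = 0) : V = 0 := by
  refine eq_zero_of_forall_scalarProduct fun U => ?_
  obtain ⟨P, hP, T, hT, rfl⟩ := Submodule.mem_sup.1
    ((exists_projection haa hab hac hbb).1.codisjoint.eq_top.symm ▸ Submodule.mem_top (x := U))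
  have hTV : scalarProduct n T V = 0 := (LinearMap.BilinForm.mem_orthogonal_iff.1 hV) T hT
  rw [map_add, LinearMap.add_apply, hTV, add_zero]
  by_contra hne
  -- If V is null and ⟨P,V⟩ ≠ 0, then ⟨sV + P, sV + P⟩ = 2s⟨P,V⟩ + ⟨P,P⟩ is affine and non-constant
  -- in s. The chosen s makes it -1.
  have hn := nonneg_of_orthogonal haa hab hac hbb (add_mem (Submodule.smul_mem _
    (-(scalarProduct n P P + 1) / (2 * scalarProduct n P V)) hV) hP)
  simp only [map_add, map_smul, LinearMap.add_apply, LinearMap.smul_apply, smul_eq_mul, h0,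
    scalarProduct_comm V P] at hn
  have e : 2 * (-(scalarProduct n P P + 1) / (2 * scalarProduct n P V) * scalarProduct n P V) =
      -(scalarProduct n P P + 1) := by field_simp
  linarith

/-- The variation of a curve in the Einstein universe in the direction of a tangent field. -/
noncomputable def tangentVariation {n : ℕ} (γ Y : ℝ → Ambient n) (t τ : ℝ) : Ambient n :=
  Fin.cons ((γ t 0 + τ * Y t 0) / √(1 + τ ^ 2 * (Y t 0 ^ 2 + Y t 1 ^ 2)))
    (Fin.cons ((γ t 1 + τ * Y t 1) / √(1 + τ ^ 2 * (Y t 0 ^ 2 + Y t 1 ^ 2)))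
      fun i : Fin n => (γ t i.succ.succ + τ * Y t i.succ.succ) /
        √(1 + τ ^ 2 * ∑ j : Fin n, Y t j.succ.succ ^ 2))

theorem hasDerivAt_div_sqrt (x y c : ℝ) :
    HasDerivAt (fun τ => (x + τ * y) / √(1 + τ ^ 2 * c)) y 0 := by
  have h1 : HasDerivAt (fun τ : ℝ => x + τ * y) y 0 := by
    simpa using ((hasDerivAt_id (0 : ℝ)).mul_const y).const_add x
  have h2 : HasDerivAt (fun τ : ℝ => 1 + τ ^ 2 * c) 0 0 := by
    simpa using (((hasDerivAt_id (0 : ℝ)).pow 2).mul_const c).const_add 1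
  have h3 := h1.fun_div (h2.sqrt (by simp)) (by simp)
  simpa using h3

theorem hasDerivAt_tangentVariation {n : ℕ} (γ Y : ℝ → Ambient n) (t : ℝ) :
    HasDerivAt (tangentVariation γ Y t) (Y t) 0 := by
  refine hasDerivAt_pi.2 fun i => ?_
  refine Fin.cases ?_ (fun j => Fin.cases ?_ (fun k => ?_) j) i
  · exact hasDerivAt_div_sqrt _ _ _
  · exact hasDerivAt_div_sqrt _ _ _
  · exact hasDerivAt_div_sqrt _ _ _

theorem tangentVariation_zero {n : ℕ} (γ Y : ℝ → Ambient n) (t : ℝ) :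
    tangentVariation γ Y t 0 = γ t := by
  ext i
  refine Fin.cases ?_ (fun j => Fin.cases ?_ (fun k => ?_) j) i <;> simp [tangentVariation]

theorem tangentVariation_eq_of_eq_zero {n : ℕ} {γ Y : ℝ → Ambient n} {t : ℝ} (h : Y t = 0)
    (τ : ℝ) : tangentVariation γ Y t τ = γ t := by
  ext i
  refine Fin.cases ?_ (fun j => Fin.cases ?_ (fun k => ?_) j) i <;> simp [tangentVariation, h]

/-- The two conditions together express tangency to each of the factors S¹ and S^{n-1}. The cross
terms vanish, so the squared length of each factor of γ + τY is 1 + τ² times that of Y, which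
explains the denominators and why they are never zero. -/
theorem isVariation_tangentVariation {n : ℕ} {I : Set ℝ} {γ Y : ℝ → Ambient n}
    (hγ : ContDiffOn ℝ ∞ γ I) (hm : ∀ t ∈ I, γ t ∈ einsteinUniverse n)
    (hY : ContDiffOn ℝ ∞ Y I) (h0 : ∀ t ∈ I, γ t 0 * Y t 0 + γ t 1 * Y t 1 = 0)
    (h1 : ∀ t ∈ I, scalarProduct n (γ t) (Y t) = 0) :
    IsVariation I γ 1 (tangentVariation γ Y) where
  pos := one_pos
  zero t _ := tangentVariation_zero γ Y t
  smooth := by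
    have c (i : Fin (n + 2)) : ContDiffOn ℝ ∞ (fun p : ℝ × ℝ => γ p.1 i) (I ×ˢ Set.Ioo (-1) 1) :=
      (contDiffOn_pi.1 hγ i).comp contDiff_fst.contDiffOn fun p hp => hp.1
    have y (i : Fin (n + 2)) : ContDiffOn ℝ ∞ (fun p : ℝ × ℝ => Y p.1 i) (I ×ˢ Set.Ioo (-1) 1) :=
      (contDiffOn_pi.1 hY i).comp contDiff_fst.contDiffOn fun p hp => hp.1
    have s : ContDiffOn ℝ ∞ (fun p : ℝ × ℝ => p.2) (I ×ˢ Set.Ioo (-1) 1) :=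
      contDiff_snd.contDiffOn
    have q {φ : ℝ × ℝ → ℝ} (hφ : ContDiffOn ℝ ∞ φ (I ×ˢ Set.Ioo (-1) 1)) (hnn : ∀ p, 0 ≤ φ p)
        (i : Fin (n + 2)) : ContDiffOn ℝ ∞ (fun p : ℝ × ℝ =>
          (γ p.1 i + p.2 * Y p.1 i) / √(1 + p.2 ^ 2 * φ p)) (I ×ˢ Set.Ioo (-1) 1) := by
      have hpos (p : ℝ × ℝ) : 0 < 1 + p.2 ^ 2 * φ p := by
        have := mul_nonneg (sq_nonneg p.2) (hnn p)
        linarith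
      exact ((c i).add (s.mul (y i))).div
        ((contDiffOn_const.add ((s.pow 2).mul hφ)).sqrt fun p _ => (hpos p).ne')
        fun p _ => (Real.sqrt_pos.2 (hpos p)).ne'
    refine contDiffOn_pi.2 fun i => ?_
    refine Fin.cases ?_ (fun j => Fin.cases ?_ (fun k => ?_) j) i
    · exact q (((y 0).pow 2).add ((y 1).pow 2)) (fun p => by positivity) 0
    · exact q (((y 0).pow 2).add ((y 1).pow 2)) (fun p => by positivity) 1
    · exact q (ContDiffOn.sum fun (j : Fin n) _ => (y j.succ.succ).pow 2)
        (fun p => Finset.sum_nonneg fun _ _ => sq_nonneg _) k.succ.succ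
  mem t ht τ _ := by
    obtain ⟨m0, m1⟩ := hm t ht
    have e0 := h0 t ht
    have e1 := h1 t ht
    rw [scalarProduct_apply] at e1
    have hs : 0 ≤ ∑ j : Fin n, Y t j.succ.succ ^ 2 := Finset.sum_nonneg fun _ _ => sq_nonneg _
    have p0 : 0 < 1 + τ ^ 2 * (Y t 0 ^ 2 + Y t 1 ^ 2) := by positivity
    have p1 : 0 < 1 + τ ^ 2 * ∑ j : Fin n, Y t j.succ.succ ^ 2 := by positivity
    constructor
    · change ((γ t 0 + τ * Y t 0) / √(1 + τ ^ 2 * (Y t 0 ^ 2 + Y t 1 ^ 2))) ^ 2 +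
        ((γ t 1 + τ * Y t 1) / √(1 + τ ^ 2 * (Y t 0 ^ 2 + Y t 1 ^ 2))) ^ 2 = 1
      rw [div_pow, div_pow, Real.sq_sqrt p0.le, ← add_div, div_eq_one_iff_eq p0.ne']
      linear_combination m0 + 2 * τ * e0
    · change ∑ i : Fin n, ((γ t i.succ.succ + τ * Y t i.succ.succ) /
        √(1 + τ ^ 2 * ∑ j : Fin n, Y t j.succ.succ ^ 2)) ^ 2 = 1
      simp only [div_pow, Real.sq_sqrt p1.le]
      rw [← Finset.sum_div, div_eq_one_iff_eq p1.ne']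
      have e2 : ∑ i : Fin n, (γ t i.succ.succ + τ * Y t i.succ.succ) ^ 2 =
          ∑ i : Fin n, γ t i.succ.succ ^ 2 +
            2 * τ * ∑ i : Fin n, γ t i.succ.succ * Y t i.succ.succ +
            τ ^ 2 * ∑ i : Fin n, Y t i.succ.succ ^ 2 := by
        simp only [Finset.mul_sum, ← Finset.sum_add_distrib]
        exact Finset.sum_congr rfl fun i _ => by ring
      rw [e2, m1]
      linear_combination 2 * τ * (e1 + e0)

/-- At a point where the gradient does not vanish, some variation changes the total strain to first
order. -/
theorem strainGradient_eq_zero {n : ℕ} {I : Set ℝ} (hI : IsOpen I) {γ : ℝ → Ambient n}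
    (hγ : IsTimelikeCurve I γ) (hgen : IsGeneric I γ) (hw : IsConformalWorldLine I γ) :
    ∀ t ∈ I, strainGradient (strainDensity γ) (canonicalLift γ) t = 0 := by
  intro t₀ ht₀
  have h := isArcLift_canonicalLift hI hγ hgen
  have hW := h.contDiffOn_strainGradient hI
  have hrel (t : ℝ) (ht : t ∈ I) : scalarProduct n (γ t)
      (strainGradient (strainDensity γ) (canonicalLift γ) t) = 0 := by
    have horth := (h.inner_strainGradient hI ht).1
    have hr : 0 < strainDensity γ t / √(-scalarProduct n (deriv γ t) (deriv γ t)) :=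
      div_pos (h.weight_pos t ht) (Real.sqrt_pos.2 (neg_pos.2 (hγ.timelike t ht)))
    change scalarProduct n (canonicalLift γ t) _ = 0 at horth
    rwa [canonicalLift_eqOn hI hγ hgen ht, unitLift, map_smul, LinearMap.smul_apply, smul_eq_mul,
      mul_eq_zero, or_iff_right hr.ne'] at horth
  have hac (t : ℝ) (ht : t ∈ I) : scalarProduct n (arcDerivIter (strainDensity γ)
      (canonicalLift γ) 1 t) (arcDerivIter (strainDensity γ) (canonicalLift γ) 1 t) = -1 :=
    h.unit t ht
  have hmem (t : ℝ) (ht : t ∈ I) := mem_orthogonal_span_triple.2 (h.inner_strainGradient hI ht)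
  have hnn (t : ℝ) (ht : t ∈ I) := nonneg_of_orthogonal (h.null t ht) (h.inner_zero_one hI ht)
    ((h.inner_zero_two hI ht).trans (by rw [hac t ht, neg_neg])) (by rw [hac t ht]; norm_num)
    (hmem t ht)
  have hdef := eq_zero_of_orthogonal (h.null t₀ ht₀) (h.inner_zero_one hI ht₀)
    ((h.inner_zero_two hI ht₀).trans (by rw [hac t₀ ht₀, neg_neg]))
    (by rw [hac t₀ ht₀]; norm_num) (hmem t₀ ht₀)
  by_contra hne
  have hpos : 0 < scalarProduct n (strainGradient (strainDensity γ) (canonicalLift γ) t₀)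
      (strainGradient (strainDensity γ) (canonicalLift γ) t₀) :=
    lt_of_le_of_ne (hnn t₀ ht₀) fun h0 => hne (hdef h0.symm)
  obtain ⟨r, hr, hball⟩ := Metric.nhds_basis_closedBall.mem_iff.1 (hI.mem_nhds ht₀)
  let φ : ContDiffBump t₀ := ⟨r / 2, r, by positivity, by linarith⟩
  rw [Real.closedBall_eq_Icc] at hball
  set W := strainGradient (strainDensity γ) (canonicalLift γ)
  -- W is orthogonal to γ for ⟨·,·⟩ but need not be tangent to S¹ and S^{n-1} separately. The
  -- multiple of γ repairs this, and it does not change the product with W, so that ⟨W,Y⟩ = φ⟨W,W⟩.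
  let Y : ℝ → Ambient n := fun t => φ t • (W t - (γ t 0 * W t 0 + γ t 1 * W t 1) • γ t)
  have hY : ContDiffOn ℝ ∞ Y I := by
    have c := contDiffOn_pi.1 hγ.smooth
    have w := contDiffOn_pi.1 hW
    exact φ.contDiff.contDiffOn.smul
      (hW.sub ((((c 0).mul (w 0)).add ((c 1).mul (w 1))).smul hγ.smooth))
  have hg : IsVariation I γ 1 (tangentVariation γ Y) := by
    refine isVariation_tangentVariation hγ.smooth hγ.mem hY (fun t ht => ?_) fun t ht => ?_
    · have := (hγ.mem t ht).1
      simp only [Y, Pi.smul_apply, Pi.sub_apply, smul_eq_mul]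
      linear_combination (-φ t * (γ t 0 * W t 0 + γ t 1 * W t 1)) * this
    · simp [Y, hrel t ht, scalarProduct_self_of_mem (hγ.mem t ht)]
  have hsupp : variationSupport I γ 1 (tangentVariation γ Y) ⊆ Set.Icc (t₀ - r) (t₀ + r) := by
    refine closure_minimal ?_ isClosed_Icc
    rintro t ⟨-, τ, -, hτ⟩
    by_contra hn
    refine hτ (tangentVariation_eq_of_eq_zero ?_ τ)
    have : φ t = 0 := φ.zero_of_le_dist (by
      rw [← Real.closedBall_eq_Icc, Metric.mem_closedBall, not_le] at hn
      exact hn.le)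
    simp [Y, this]
  have key := (hasDerivAt_totalStrain hI hγ hgen hg (by linarith) hball hsupp).unique
    (hw _ _ (by linarith) hball _ _ hg hsupp)
  have hint : 0 < ∫ t in (t₀ - r)..(t₀ + r), strainDensity γ t *
      scalarProduct n (W t) (variationField γ (tangentVariation γ Y) t) := by
    have e (t : ℝ) (ht : t ∈ I) : strainDensity γ t *
        scalarProduct n (W t) (variationField γ (tangentVariation γ Y) t) =
        strainDensity γ t * (strainDensity γ t / √(-scalarProduct n (deriv γ t) (deriv γ t))) *
          (φ t * scalarProduct n (W t) (W t)) := by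
      have hγW : scalarProduct n (W t) (γ t) = 0 := by rw [scalarProduct_comm, hrel t ht]
      rw [inner_strainGradient_variationField hI hγ hgen hg ht,
        (hasDerivAt_tangentVariation γ Y t).deriv]
      change _ * (_ * scalarProduct n (W t) (Y t)) = _
      simp only [Y, map_smul, map_sub, smul_eq_mul, hγW, mul_zero, sub_zero]
      ring
    have hρ (t : ℝ) (ht : t ∈ I) : 0 <
        strainDensity γ t * (strainDensity γ t / √(-scalarProduct n (deriv γ t) (deriv γ t))) :=
      mul_pos (h.weight_pos t ht) (div_pos (h.weight_pos t ht)
        (Real.sqrt_pos.2 (neg_pos.2 (hγ.timelike t ht))))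
    refine intervalIntegral.integral_pos (by linarith) ?_ (fun t ht => ?_)
      ⟨t₀, ⟨by linarith, by linarith⟩, ?_⟩
    · exact (h.weight_smooth.mul (contDiffOn_scalarProduct hW
        (contDiffOn_variationField hI hγ hgen hg))).continuousOn.mono hball
    · have ht' := hball (Set.Ioc_subset_Icc_self ht)
      rw [e t ht']
      exact mul_nonneg (hρ t ht').le (mul_nonneg φ.nonneg (hnn t ht'))
    · rw [e t₀ ht₀]
      refine mul_pos (hρ t₀ ht₀) (mul_pos (φ.pos_of_mem_ball ?_) hpos)
      exact Metric.mem_ball_self hr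
  linarith

end ConformalStrain

/-! ### The characterization of conformal world-lines -/

theorem theorem3p1 (n : ℕ) (hn : 3 ≤ n) (I : Set ℝ) (hIo : IsOpen I) (hIc : I.OrdConnected)
    (γ : ℝ → ConformalStrain.Ambient n)
    (hγ : ConformalStrain.IsTimelikeCurve I γ)
    (hgen : ConformalStrain.IsGeneric I γ)
    (hor : ConformalStrain.IsIntrinsicallyOriented I γ) :
    ConformalStrain.IsConformalWorldLine I γ ↔ ∀ t ∈ I, ConformalStrain.Wsec γ t = 0 := by
  have h := ConformalStrain.isArcLift_canonicalLift hIo hγ hgen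
  have hW := ConformalStrain.Wsec_eqOn hIo h
  constructor
  · intro hw t ht
    rw [hW ht]
    exact ConformalStrain.strainGradient_eq_zero hIo hγ hgen hw t ht
  · intro hz a b hab hK ε g hg hsupp
    refine (ConformalStrain.hasDerivAt_totalStrain hIo hγ hgen hg hab hK hsupp).congr_deriv ?_
    rw [intervalIntegral.integral_congr (g := fun _ => 0) fun t ht => ?_]
    · simp
    · rw [Set.uIcc_of_le hab] at ht
      have := hz t (hK ht)
      rw [hW (hK ht)] at this
      simp [this]
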